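/- Let $k$ be a field with $\operatorname{char} k\ne 2,3$, let $\Gamma$ be an abelian group, and let $\varepsilon:\Gamma\times\Gamma\to k\setminus\{0\}$ be a commutation factor, i.e. a map that is multiplicative in each argument and satisfies $\varepsilon(\alpha,\beta)\varepsilon(\beta,\alpha)=1$. A color Lie algebra is a $\Gamma$-graded vector space $g=\bigoplus_{\gamma\in\Gamma} g_\gamma$ with a bilinear bracket such that $\langle g_\alpha,g_\beta\rangle\subseteq g_{\alpha+\beta}$, and for $a\in g_\alpha$, $b\in g_\beta$, $c\in g_\gamma$ one has $\langle a,b\rangle=-\varepsilon(\alpha,\beta)\langle b,a\rangle$ and $$\varepsilon(\gamma,\alpha)\langle a,\langle b,c\rangle\rangle+\varepsilon(\beta,\gamma)\langle c,\langle a,b\rangle\rangle+\varepsilon(\alpha,\beta)\langle b,\langle c,a\rangle\rangle=0.$$ It is abelian if its bracket is zero. Its universal enveloping algebra $U(g)$ is the quotient of the tensor algebra $T(g)$ by the relations $ab-\varepsilon(\alpha,\beta)ba=\langle a,b\rangle$ for $a\in g_\alpha$, $b\in g_\beta$. Let $g$ be a finite-dimensional abelian color Lie algebra and $R=U(g)$.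 For $n\ge 0$ let $R_n$ be the span of the products of $n$ elements of the image of $g$ (with $R_0$ the span of $1$). Then $R$, with the components $R_n$, is a homogeneous Koszul algebra, that is: 1. $R$ is a standard algebra: $R=\bigoplus_{n\ge 0}R_n$ is a graded algebra with finite-dimensional components, $R_0=k$, and $R$ is generated by $R_1$ and the unit; 2. the trivial right module $k_R=R/R_+$, where $R_+=\bigoplus_{n>0}R_n$, has a linear free resolution, i.e. a graded free resolution $\cdots\to P_1\to P_0\to k_R\to 0$ in which $P_i$ is free of finite rank on generators of degree $i$; equivalently, for every $i\ge 0$ the graded vector space $H_iR=\operatorname{Tor}_i^R(k,k)$ (computed by any graded free resolution of $k_R$) is concentrated in degree $i$. -/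

import Mathlib

/-! ### Color Lie algebras and their universal enveloping algebras -/

/-- A commutation factor on the abelian group `Γ` with values in `k \ {0}`. -/
structure CommutationFactor (k Γ : Type*) [Field k] [AddCommGroup Γ] where
  /-- the underlying map `Γ × Γ → k \ {0}` -/
  toFun : Γ → Γ → kˣ
  map_add_left : ∀ α β γ, toFun (α + β) γ = toFun α γ * toFun β γ
  map_add_right : ∀ α β γ, toFun α (β + γ) = toFun α β * toFun α γ
  mul_swap : ∀ α β, toFun α β * toFun β α = 1

/-- The structure of a `Γ`-graded `ε`-Lie algebra (a color Lie algebra) on the vector space `L`. -/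
structure ColorLieAlgebra {k Γ : Type*} [Field k] [AddCommGroup Γ] [DecidableEq Γ]
    (ε : CommutationFactor k Γ) (L : Type*) [AddCommGroup L] [Module k L] where
  /-- the homogeneous components -/
  component : Γ → Submodule k L
  isInternal : DirectSum.IsInternal component
  /-- the bilinear bracket -/
  bracket : L →ₗ[k] L →ₗ[k] L
  bracket_mem : ∀ α β, ∀ a ∈ component α, ∀ b ∈ component β,
    bracket a b ∈ component (α + β)
  bracket_skew : ∀ α β, ∀ a ∈ component α, ∀ b ∈ component β,
    bracket a b = -((ε.toFun α β : k) • bracket b a)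
  jacobi : ∀ α β γ, ∀ a ∈ component α, ∀ b ∈ component β, ∀ c ∈ component γ,
    (ε.toFun γ α : k) • bracket a (bracket b c)
      + (ε.toFun β γ : k) • bracket c (bracket a b)
      + (ε.toFun α β : k) • bracket b (bracket c a) = 0

namespace ColorLieAlgebra

variable {k Γ : Type*} [Field k] [AddCommGroup Γ] [DecidableEq Γ] {ε : CommutationFactor k Γ}
  {L : Type*} [AddCommGroup L] [Module k L]

/-- A color Lie algebra is abelian if its bracket vanishes. -/
def IsAbelian (g : ColorLieAlgebra ε L) : Prop := ∀ a b, g.bracket a b = 0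

/-- The defining relations `a b - ε(α, β) b a = ⟨a, b⟩` (for homogeneous `a`, `b` of degrees
`α`, `β`) of the universal enveloping algebra, in the tensor algebra of `L`. -/
inductive EnvelopeRel (g : ColorLieAlgebra ε L) : TensorAlgebra k L → TensorAlgebra k L → Prop
  | comm (α β : Γ) (a b : L) (ha : a ∈ g.component α) (hb : b ∈ g.component β) :
      EnvelopeRel g
        (TensorAlgebra.ι k a * TensorAlgebra.ι k b
          - (ε.toFun α β : k) • (TensorAlgebra.ι k b * TensorAlgebra.ι k a))
        (TensorAlgebra.ι k (g.bracket a b))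

/-- The universal enveloping algebra `U(g)`: the tensor algebra modulo the defining relations. -/
abbrev Envelope (g : ColorLieAlgebra ε L) := RingQuot g.EnvelopeRel

/-- The canonical map `g → U(g)`. -/
noncomputable def envelopeι (g : ColorLieAlgebra ε L) : L →ₗ[k] g.Envelope :=
  (RingQuot.mkAlgHom k g.EnvelopeRel).toLinearMap ∘ₗ TensorAlgebra.ι k

/-- The degree `n` component of `U(g)` with respect to word length in the generators `g`:
the span of all products of `n` elements of the image of `g` (for `n = 0`, the span of `1`). -/
noncomputable def envelopeDegree (g : ColorLieAlgebra ε L) (n : ℕ) : Submodule k g.Envelope :=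
  LinearMap.range g.envelopeι ^ n

end ColorLieAlgebra

/-! ### Graded algebras, graded free resolutions of the trivial module, and Koszulity -/

namespace GradedKoszul

open MulOpposite

universe u v w

variable {k : Type u} {R : Type v} [Field k] [Ring R] [Algebra k R]

/-- The subspaces `𝒜 n` make `R` a standard algebra: a `ℕ`-graded algebra with finite-dimensional
components and zero component `k`, generated by its component of degree one and the unit. -/
structure IsStandard (𝒜 : ℕ → Submodule k R) : Prop where
  gradedMonoid : SetLike.GradedMonoid 𝒜
  isInternal : DirectSum.IsInternal 𝒜
  finite : ∀ n, Module.Finite k (𝒜 n)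
  algebraMap_injective : Function.Injective (algebraMap k R)
  zero_eq : 𝒜 0 = LinearMap.range (Algebra.linearMap k R)
  adjoin_one : Algebra.adjoin k (𝒜 1 : Set R) = ⊤

/-- The augmentation ideal `R₊`, generated (as a right ideal) by the components of positive
degree. Right `R`-modules are modules over `Rᵐᵒᵖ`. The trivial right module is `R ⧸ R₊`, which
is `k` if `𝒜` is a connected grading. -/
def augIdeal (𝒜 : ℕ → Submodule k R) : Submodule Rᵐᵒᵖ R :=
  Submodule.span Rᵐᵒᵖ {r : R | ∃ n, 0 < n ∧ r ∈ 𝒜 n}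

/-- The component of degree `j` of the graded free right module `⨁ₓ R(-deg x)`
with a basis of elements `x : X` of degrees `deg x`. -/
def freeDegree (𝒜 : ℕ → Submodule k R) {X : Type w} (deg : X → ℕ) (j : ℕ) :
    Submodule k (X →₀ R) where
  carrier := {f | ∀ x, f x ∈ if deg x ≤ j then 𝒜 (j - deg x) else ⊥}
  add_mem' hf hg x := Submodule.add_mem _ (hf x) (hg x)
  zero_mem' _ := Submodule.zero_mem _
  smul_mem' c _ hf x := Submodule.smul_mem _ c (hf x)

/-- A graded free resolution `⋯ → P₁ → P₀ → k → 0` of the trivial right module `R ⧸ R₊`, with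
`Pᵢ` the graded free right module on generators `gen i` of degrees `deg i` and with differentials
and augmentation of degree zero. -/
structure FreeResolution (𝒜 : ℕ → Submodule k R) where
  gen : ℕ → Type w
  deg : ∀ i, gen i → ℕ
  d : ∀ i, (gen (i + 1) →₀ R) →ₗ[Rᵐᵒᵖ] (gen i →₀ R)
  aug : (gen 0 →₀ R) →ₗ[Rᵐᵒᵖ] (R ⧸ augIdeal 𝒜)
  d_mem : ∀ i j, ∀ f ∈ freeDegree 𝒜 (deg (i + 1)) j, d i f ∈ freeDegree 𝒜 (deg i) j
  aug_mem : ∀ j, ∀ f ∈ freeDegree 𝒜 (deg 0) j, ∃ r ∈ 𝒜 j, aug f = Submodule.Quotient.mk r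
  aug_surjective : Function.Surjective aug
  exact_aug : Function.Exact (d 0) aug
  exact_d : ∀ i, Function.Exact (d (i + 1)) (d i)

/-- The submodule `M R₊` of a right module `M`. -/
def mulAug (𝒜 : ℕ → Submodule k R) (M : Type*) [AddCommGroup M] [Module Rᵐᵒᵖ M] :
    Submodule Rᵐᵒᵖ M :=
  Submodule.span Rᵐᵒᵖ {m : M | ∃ x : M, ∃ r ∈ augIdeal 𝒜, m = op r • x}

theorem mulAug_le_comap (𝒜 : ℕ → Submodule k R) {M N : Type*} [AddCommGroup M] [Module Rᵐᵒᵖ M]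
    [AddCommGroup N] [Module Rᵐᵒᵖ N] (f : M →ₗ[Rᵐᵒᵖ] N) :
    mulAug 𝒜 M ≤ (mulAug 𝒜 N).comap f := by
  refine Submodule.span_le.2 ?_
  rintro _ ⟨x, r, hr, rfl⟩
  exact Submodule.subset_span ⟨f x, r, hr, map_smul f (op r) x⟩

namespace FreeResolution

variable {𝒜 : ℕ → Submodule k R} (P : FreeResolution.{u, v, w} 𝒜)

/-- The vector space `Pᵢ ⊗_R k = Pᵢ / Pᵢ R₊`. -/
abbrev Red (i : ℕ) := (P.gen i →₀ R) ⧸ mulAug 𝒜 (P.gen i →₀ R)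

/-- The differential `Pᵢ₊₁ ⊗_R k → Pᵢ ⊗_R k`. -/
noncomputable def redD (i : ℕ) : P.Red (i + 1) →ₗ[k] P.Red i :=
  (Submodule.mapQ _ _ (P.d i) (mulAug_le_comap 𝒜 (P.d i))).restrictScalars k

/-- The component of degree `j` of `Pᵢ ⊗_R k`. -/
noncomputable def redDegree (i j : ℕ) : Submodule k (P.Red i) :=
  (freeDegree 𝒜 (P.deg i) j).map ((mulAug 𝒜 (P.gen i →₀ R)).mkQ.restrictScalars k)

/-- The cycles of `P ⊗_R k` of homological degree `i` and internal degree `j`. -/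
noncomputable def cycles : (i j : ℕ) → Submodule k (P.Red i)
  | 0, j => P.redDegree 0 j
  | i + 1, j => P.redDegree (i + 1) j ⊓ LinearMap.ker (P.redD i)

/-- The boundaries of `P ⊗_R k` of homological degree `i` and internal degree `j`. -/
noncomputable def boundaries (i j : ℕ) : Submodule k (P.Red i) :=
  (P.redDegree (i + 1) j).map (P.redD i)

/-- `Tor_i^R(k, k)_j`, computed by the graded free resolution `P`: the component of internal
degree `j` of the `i`-th homology of `P ⊗_R k`. -/
abbrev Tor (i j : ℕ) := P.cycles i j ⧸ (P.boundaries i j).submoduleOf (P.cycles i j)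

end FreeResolution

/-- The algebra `R` with the grading `𝒜` is homogeneous Koszul: it is standard, its trivial right
module has a linear free resolution (of finite rank in each homological degree, with
generators of `Pᵢ` in degree `i`), and `H_i R = Tor_i^R(k, k)`, computed by any graded free
resolution, is concentrated in degree `i`. -/
structure IsHomogeneousKoszul (𝒜 : ℕ → Submodule k R) : Prop where
  isStandard : IsStandard 𝒜
  exists_linear : ∃ P : FreeResolution.{u, v, v} 𝒜,
    ∀ i, Finite (P.gen i) ∧ ∀ x : P.gen i, P.deg i x = i
  tor_eq_zero : ∀ P : FreeResolution.{u, v, v} 𝒜, ∀ i j, j ≠ i → Subsingleton (P.Tor i j)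

end GradedKoszul

/-!
A basis `x` of `g` consisting of homogeneous elements satisfies `x i * x j = q i j • (x j * x i)` in
`U(g)`, where `q i j` is the value of `ε` at the degrees of `x i` and `x j`. So `x i` squares to
zero if it is odd, that is, if `q i i ≠ 1`, and the ordered monomials in which the odd variables
occur at most once span `U(g)`. They are linearly independent, because the formal ordered monomials
carry a representation of `U(g)` in which `x l` multiplies a monomial by the `l`-th variable and
sorts the result.

The Koszul complex is free on monomials in dual variables, in which it is now the even variables
that occur at most once, with the differential `∑ l, x l • ∂ l`. It is exact: if the first variable
occurring in a term `generator ⊗ monomial` occurs in the monomial, then moving one copy of it to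
the generator is a contracting homotopy, because in `d s + s d` everything cancels except for the
contribution of this first variable, which reproduces the term. Hence the trivial module has a
linear resolution `Q`.

Any graded free resolution `P` maps to `Q` and back, and the composite is homotopic to the identity.
In homological degree `i` the generators of `Q` have degree `i`, so the composite sends elements of
degree `j ≠ i` into `P R₊`, and therefore `Tor i j` vanishes.
-/

namespace GradedKoszul

open MulOpposite

universe u v w w'

variable {k : Type u} {R : Type v} [Field k] [Ring R] [Algebra k R]

/-! ### Graded free modules -/

section Free

variable {𝒜 : ℕ → Submodule k R} {X Y Z N : Type*} [AddCommGroup N] [Module Rᵐᵒᵖ N]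

/-- The homomorphism of right modules out of a free module with prescribed values on the
generators. -/
noncomputable def freeLift (n : X → N) : (X →₀ R) →ₗ[Rᵐᵒᵖ] N :=
  Finsupp.lsum ℕ fun x =>
    { toFun := fun r => op r • n x
      map_add' := fun r s => by rw [op_add, add_smul]
      map_smul' := fun c r => by
        rw [smul_eq_mul_unop, op_mul, op_unop, mul_smul, RingHom.id_apply] }

@[simp]
theorem freeLift_single (n : X → N) (x : X) (r : R) :
    freeLift n (Finsupp.single x r) = op r • n x := by
  simp [freeLift]

theorem single_eq_op_smul_single_one (x : X) (r : R) :
    Finsupp.single x r = op r • Finsupp.single x (1 : R) := by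
  simp

theorem linearMap_ext_single_one {f g : (X →₀ R) →ₗ[Rᵐᵒᵖ] N}
    (h : ∀ x, f (Finsupp.single x 1) = g (Finsupp.single x 1)) : f = g := by
  refine LinearMap.ext fun z => ?_
  induction z using Finsupp.induction_linear with
  | zero => simp only [map_zero]
  | add a b ha hb => rw [map_add, map_add, ha, hb]
  | single x r => rw [single_eq_op_smul_single_one, map_smul, map_smul, h]

theorem single_mem_freeDegree {r : R} {i : ℕ} (hr : r ∈ 𝒜 i) (deg : X → ℕ) (x : X) :
    Finsupp.single x r ∈ freeDegree 𝒜 deg (deg x + i) := by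
  classical
  intro y
  obtain rfl | hxy := eq_or_ne x y
  · simpa using hr
  · rw [Finsupp.single_eq_of_ne' hxy]
    exact zero_mem _

theorem single_one_mem_freeDegree [SetLike.GradedMonoid 𝒜] (deg : X → ℕ) (x : X) :
    Finsupp.single x (1 : R) ∈ freeDegree 𝒜 deg (deg x) :=
  single_mem_freeDegree (SetLike.one_mem_graded 𝒜) deg x

theorem op_smul_mem_freeDegree [SetLike.GradedMonoid 𝒜] {deg : X → ℕ} {i j : ℕ} {f : X →₀ R}
    (hf : f ∈ freeDegree 𝒜 deg i) {r : R} (hr : r ∈ 𝒜 j) :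
    op r • f ∈ freeDegree 𝒜 deg (i + j) := by
  intro x
  have hfx := hf x
  rw [Finsupp.smul_apply, op_smul_eq_mul]
  split_ifs at hfx with hx
  · rw [if_pos (by omega), Nat.sub_add_comm hx]
    exact SetLike.mul_mem_graded hfx hr
  · rw [(Submodule.mem_bot k).1 hfx, zero_mul]
    exact zero_mem _

variable (𝒜) in
/-- Homomorphisms of degree zero between graded free modules. -/
def PreservesDegree (deg : X → ℕ) (deg' : Y → ℕ) (φ : (X →₀ R) →ₗ[Rᵐᵒᵖ] (Y →₀ R)) : Prop :=
  ∀ j, ∀ f ∈ freeDegree 𝒜 deg j, φ f ∈ freeDegree 𝒜 deg' j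

namespace PreservesDegree

variable {degX : X → ℕ} {degY : Y → ℕ} {degZ : Z → ℕ}

theorem id : PreservesDegree 𝒜 degX degX LinearMap.id := fun _ _ hf => hf

theorem comp {ψ : (Y →₀ R) →ₗ[Rᵐᵒᵖ] (Z →₀ R)} (hψ : PreservesDegree 𝒜 degY degZ ψ)
    {φ : (X →₀ R) →ₗ[Rᵐᵒᵖ] (Y →₀ R)} (hφ : PreservesDegree 𝒜 degX degY φ) :
    PreservesDegree 𝒜 degX degZ (ψ ∘ₗ φ) :=
  fun j f hf => hψ j _ (hφ j f hf)

theorem sub {φ ψ : (X →₀ R) →ₗ[Rᵐᵒᵖ] (Y →₀ R)} (hφ : PreservesDegree 𝒜 degX degY φ)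
    (hψ : PreservesDegree 𝒜 degX degY ψ) : PreservesDegree 𝒜 degX degY (φ - ψ) :=
  fun j f hf => sub_mem (hφ j f hf) (hψ j f hf)

theorem of_single_one [SetLike.GradedMonoid 𝒜] {φ : (X →₀ R) →ₗ[Rᵐᵒᵖ] (Y →₀ R)}
    (hφ : ∀ x, φ (Finsupp.single x 1) ∈ freeDegree 𝒜 degY (degX x)) :
    PreservesDegree 𝒜 degX degY φ := by
  intro j f hf
  rw [← Finsupp.sum_single f, Finsupp.sum, map_sum]
  refine sum_mem fun x _ => ?_
  rw [single_eq_op_smul_single_one, map_smul]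
  have hfx := hf x
  split_ifs at hfx with hx
  · simpa only [Nat.add_sub_cancel' hx] using op_smul_mem_freeDegree (hφ x) hfx
  · rw [(Submodule.mem_bot k).1 hfx, op_zero, zero_smul]
    exact zero_mem _

end PreservesDegree

theorem mem_augIdeal_of_mem {n : ℕ} (hn : n ≠ 0) {r : R} (hr : r ∈ 𝒜 n) : r ∈ augIdeal 𝒜 :=
  Submodule.subset_span ⟨n, Nat.pos_of_ne_zero hn, hr⟩

theorem mem_mulAug_of_mem_freeDegree {deg : X → ℕ} {i j : ℕ} (hdeg : ∀ x, deg x = i) (hij : j ≠ i)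
    {f : X →₀ R} (hf : f ∈ freeDegree 𝒜 deg j) : f ∈ mulAug 𝒜 (X →₀ R) := by
  rw [← Finsupp.sum_single f]
  refine sum_mem fun x _ => ?_
  have hfx := hf x
  rw [hdeg] at hfx
  split_ifs at hfx with hi
  · rw [single_eq_op_smul_single_one]
    exact Submodule.subset_span ⟨_, _, mem_augIdeal_of_mem (by omega) hfx, rfl⟩
  · rw [(Submodule.mem_bot k).1 hfx, Finsupp.single_zero]
    exact zero_mem _

section GradedAlgebra

variable [GradedAlgebra 𝒜]

theorem freeDegree_induction {p : (X →₀ R) → Prop} (deg : X → ℕ)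
    (mem : ∀ j, ∀ f ∈ freeDegree 𝒜 deg j, p f) (add : ∀ f g, p f → p g → p (f + g))
    (f : X →₀ R) : p f := by
  have zero : p 0 := mem 0 0 (zero_mem _)
  induction f using Finsupp.induction_linear with
  | zero => exact zero
  | add f g hf hg => exact add f g hf hg
  | single x r =>
    induction r using DirectSum.Decomposition.inductionOn 𝒜 with
    | zero => rwa [Finsupp.single_zero]
    | homogeneous r => exact mem _ _ (single_mem_freeDegree r.2 deg x)
    | add r s hr hs =>
      rw [Finsupp.single_add]
      exact add _ _ hr hs

variable (𝒜) in
/-- The projection of a graded free module onto its component of degree `j`. -/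
noncomputable def freeProj (deg : X → ℕ) (j : ℕ) : (X →₀ R) →ₗ[k] (X →₀ R) :=
  Finsupp.lsum k fun x =>
    Finsupp.lsingle x ∘ₗ if deg x ≤ j then GradedAlgebra.proj 𝒜 (j - deg x) else 0

theorem freeProj_apply (deg : X → ℕ) (j : ℕ) (f : X →₀ R) (x : X) :
    freeProj 𝒜 deg j f x = if deg x ≤ j then GradedAlgebra.proj 𝒜 (j - deg x) (f x) else 0 := by
  classical
  induction f using Finsupp.induction_linear with
  | zero => simp
  | add f g hf hg =>
    rw [map_add, Finsupp.add_apply, hf, hg, Finsupp.add_apply, map_add]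
    split_ifs <;> simp only [add_zero]
  | single y r =>
    rw [freeProj, Finsupp.lsum_single, LinearMap.comp_apply, Finsupp.lsingle_apply]
    obtain rfl | hyx := eq_or_ne y x
    · split_ifs <;> simp
    · simp [Finsupp.single_eq_of_ne' hyx]

theorem freeProj_mem (deg : X → ℕ) (j : ℕ) (f : X →₀ R) :
    freeProj 𝒜 deg j f ∈ freeDegree 𝒜 deg j := by
  intro x
  rw [freeProj_apply]
  split_ifs
  · exact SetLike.coe_mem _
  · exact zero_mem _

theorem freeProj_of_mem_same {deg : X → ℕ} {j : ℕ} {f : X →₀ R} (hf : f ∈ freeDegree 𝒜 deg j) :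
    freeProj 𝒜 deg j f = f := by
  ext x
  have hfx := hf x
  rw [freeProj_apply]
  split_ifs at hfx ⊢
  · exact DirectSum.decompose_of_mem_same _ hfx
  · exact ((Submodule.mem_bot k).1 hfx).symm

theorem freeProj_of_mem_ne {deg : X → ℕ} {i j : ℕ} (hij : i ≠ j) {f : X →₀ R}
    (hf : f ∈ freeDegree 𝒜 deg i) : freeProj 𝒜 deg j f = 0 := by
  ext x
  have hfx := hf x
  rw [freeProj_apply, Finsupp.zero_apply]
  split_ifs at hfx ⊢
  · exact DirectSum.decompose_of_mem_ne _ hfx (by omega)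
  · rw [(Submodule.mem_bot k).1 hfx, map_zero]
  all_goals rfl

theorem PreservesDegree.map_freeProj {deg : X → ℕ} {deg' : Y → ℕ}
    {φ : (X →₀ R) →ₗ[Rᵐᵒᵖ] (Y →₀ R)} (hφ : PreservesDegree 𝒜 deg deg' φ) (j : ℕ) (f : X →₀ R) :
    φ (freeProj 𝒜 deg j f) = freeProj 𝒜 deg' j (φ f) := by
  induction f using freeDegree_induction (𝒜 := 𝒜) deg with
  | mem i f hf =>
    obtain rfl | hij := eq_or_ne i j
    · rw [freeProj_of_mem_same hf, freeProj_of_mem_same (hφ i f hf)]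
    · rw [freeProj_of_mem_ne hij hf, freeProj_of_mem_ne hij (hφ i f hf), map_zero]
  | add f g hf hg => rw [map_add, map_add, hf, hg, map_add, map_add]

theorem PreservesDegree.exists_homogeneous_preimage {deg : X → ℕ} {deg' : Y → ℕ}
    {φ : (X →₀ R) →ₗ[Rᵐᵒᵖ] (Y →₀ R)} (hφ : PreservesDegree 𝒜 deg deg' φ) {j : ℕ} {z : Y →₀ R}
    (hz : z ∈ freeDegree 𝒜 deg' j) (hz' : z ∈ LinearMap.range φ) :
    ∃ w ∈ freeDegree 𝒜 deg j, φ w = z := by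
  obtain ⟨w, rfl⟩ := hz'
  exact ⟨freeProj 𝒜 deg j w, freeProj_mem deg j w, by
    rw [hφ.map_freeProj, freeProj_of_mem_same hz]⟩

theorem PreservesDegree.exists_lift {degX : X → ℕ} {degY : Y → ℕ} {degZ : Z → ℕ}
    {δ : (Y →₀ R) →ₗ[Rᵐᵒᵖ] (Z →₀ R)} (hδ : PreservesDegree 𝒜 degY degZ δ)
    {ψ : (X →₀ R) →ₗ[Rᵐᵒᵖ] (Z →₀ R)} (hψ : PreservesDegree 𝒜 degX degZ ψ)
    (hrange : LinearMap.range ψ ≤ LinearMap.range δ) :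
    ∃ σ : (X →₀ R) →ₗ[Rᵐᵒᵖ] (Y →₀ R), PreservesDegree 𝒜 degX degY σ ∧ δ ∘ₗ σ = ψ := by
  choose n hn hn' using fun x : X => hδ.exists_homogeneous_preimage
    (hψ _ _ (single_one_mem_freeDegree degX x)) (hrange ⟨_, rfl⟩)
  refine ⟨freeLift n, .of_single_one fun x => ?_, linearMap_ext_single_one fun x => ?_⟩
  · simpa using hn x
  · simpa using hn' x

end GradedAlgebra

end Free

/-! ### The comparison theorem -/

theorem exists_dependent_seq {S : ℕ → Type*} {r : ∀ i, S i → S (i + 1) → Prop} (s₀ : S 0)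
    (step : ∀ i s, ∃ s', r i s s') : ∃ F : ∀ i, S i, F 0 = s₀ ∧ ∀ i, r i (F i) (F (i + 1)) := by
  choose next hnext using step
  exact ⟨fun i => Nat.rec s₀ next i, rfl, fun i => hnext i _⟩

namespace FreeResolution

variable {𝒜 : ℕ → Submodule k R}

section GradedAlgebra

variable [GradedAlgebra 𝒜]

theorem aug_freeProj_zero (Q : FreeResolution.{u, v, w} 𝒜) (f : Q.gen 0 →₀ R) :
    Q.aug (freeProj 𝒜 (Q.deg 0) 0 f) = Q.aug f := by
  induction f using freeDegree_induction (𝒜 := 𝒜) (Q.deg 0) with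
  | mem i f hf =>
    obtain rfl | hi := eq_or_ne i 0
    · rw [freeProj_of_mem_same hf]
    · obtain ⟨s, hs, hfs⟩ := Q.aug_mem i f hf
      rw [freeProj_of_mem_ne hi hf, map_zero, hfs, eq_comm, Submodule.Quotient.mk_eq_zero]
      exact mem_augIdeal_of_mem hi hs
  | add f g hf hg => rw [map_add, map_add, hf, hg, map_add]

theorem exists_homogeneous_aug_preimage (Q : FreeResolution.{u, v, w} 𝒜) {j : ℕ} {r : R}
    (hr : r ∈ 𝒜 j) : ∃ q ∈ freeDegree 𝒜 (Q.deg 0) j, Q.aug q = Submodule.Quotient.mk r := by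
  obtain rfl | hj := eq_or_ne j 0
  · obtain ⟨q, hq⟩ := Q.aug_surjective (Submodule.Quotient.mk r)
    exact ⟨_, freeProj_mem _ _ q, by rw [aug_freeProj_zero, hq]⟩
  · refine ⟨0, zero_mem _, ?_⟩
    rw [map_zero, eq_comm, Submodule.Quotient.mk_eq_zero]
    exact mem_augIdeal_of_mem hj hr

theorem exists_lift_aug (P : FreeResolution.{u, v, w} 𝒜) (Q : FreeResolution.{u, v, w'} 𝒜) :
    ∃ f : (P.gen 0 →₀ R) →ₗ[Rᵐᵒᵖ] (Q.gen 0 →₀ R),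
      PreservesDegree 𝒜 (P.deg 0) (Q.deg 0) f ∧ Q.aug ∘ₗ f = P.aug := by
  choose r hr hr' using fun x => P.aug_mem _ _ (single_one_mem_freeDegree (P.deg 0) x)
  choose q hq hq' using fun x => exists_homogeneous_aug_preimage Q (hr x)
  refine ⟨freeLift q, .of_single_one fun x => ?_, linearMap_ext_single_one fun x => ?_⟩
  · simpa using hq x
  · simp [hq', hr']

theorem exists_chainMap (P : FreeResolution.{u, v, w} 𝒜) (Q : FreeResolution.{u, v, w'} 𝒜) :
    ∃ f : ∀ i, (P.gen i →₀ R) →ₗ[Rᵐᵒᵖ] (Q.gen i →₀ R),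
      (∀ i, PreservesDegree 𝒜 (P.deg i) (Q.deg i) (f i)) ∧ Q.aug ∘ₗ f 0 = P.aug ∧
      ∀ i, Q.d i ∘ₗ f (i + 1) = f i ∘ₗ P.d i := by
  obtain ⟨f₀, hf₀, hf₀aug⟩ := exists_lift_aug P Q
  let S (i : ℕ) := {f : (P.gen i →₀ R) →ₗ[Rᵐᵒᵖ] (Q.gen i →₀ R) //
    PreservesDegree 𝒜 (P.deg i) (Q.deg i) f ∧
      LinearMap.range (f ∘ₗ P.d i) ≤ LinearMap.range (Q.d i)}
  have hrange₀ : LinearMap.range (f₀ ∘ₗ P.d 0) ≤ LinearMap.range (Q.d 0) := by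
    rintro _ ⟨z, rfl⟩
    refine (Q.exact_aug _).1 ?_
    rw [LinearMap.comp_apply, ← LinearMap.comp_apply, hf₀aug, P.exact_aug.apply_apply_eq_zero]
  obtain ⟨F, hF₀, hF⟩ := exists_dependent_seq (S := S)
    (r := fun i f f' => Q.d i ∘ₗ f'.1 = f.1 ∘ₗ P.d i) ⟨f₀, hf₀, hrange₀⟩ fun i ⟨f, hf, hfd⟩ => by
      obtain ⟨σ, hσ, hσd⟩ := PreservesDegree.exists_lift (Q.d_mem i) (hf.comp (P.d_mem i)) hfd
      refine ⟨⟨σ, hσ, ?_⟩, hσd⟩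
      rintro _ ⟨z, rfl⟩
      refine (Q.exact_d i _).1 ?_
      rw [LinearMap.comp_apply, ← LinearMap.comp_apply, hσd, LinearMap.comp_apply,
        (P.exact_d i).apply_apply_eq_zero, map_zero]
  exact ⟨fun i => (F i).1, fun i => (F i).2.1, by simpa only [hF₀] using hf₀aug, hF⟩

theorem exists_homotopy (P : FreeResolution.{u, v, w} 𝒜)
    {φ : ∀ i, (P.gen i →₀ R) →ₗ[Rᵐᵒᵖ] (P.gen i →₀ R)}
    (hφ : ∀ i, PreservesDegree 𝒜 (P.deg i) (P.deg i) (φ i)) (hφ₀ : P.aug ∘ₗ φ 0 = 0)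
    (hφd : ∀ i, P.d i ∘ₗ φ (i + 1) = φ i ∘ₗ P.d i) :
    ∃ s : ∀ i, (P.gen i →₀ R) →ₗ[Rᵐᵒᵖ] (P.gen (i + 1) →₀ R),
      (∀ i, PreservesDegree 𝒜 (P.deg i) (P.deg (i + 1)) (s i)) ∧ P.d 0 ∘ₗ s 0 = φ 0 ∧
      ∀ i, P.d (i + 1) ∘ₗ s (i + 1) = φ (i + 1) - s i ∘ₗ P.d i := by
  obtain ⟨s₀, hs₀, hs₀d⟩ := PreservesDegree.exists_lift (P.d_mem 0) (hφ 0) <| by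
    rintro _ ⟨z, rfl⟩
    exact (P.exact_aug _).1 (LinearMap.congr_fun hφ₀ z)
  let S (i : ℕ) := {s : (P.gen i →₀ R) →ₗ[Rᵐᵒᵖ] (P.gen (i + 1) →₀ R) //
    PreservesDegree 𝒜 (P.deg i) (P.deg (i + 1)) s ∧ P.d i ∘ₗ s ∘ₗ P.d i = φ i ∘ₗ P.d i}
  obtain ⟨F, hF₀, hF⟩ := exists_dependent_seq (S := S)
    (r := fun i s s' => P.d (i + 1) ∘ₗ s'.1 = φ (i + 1) - s.1 ∘ₗ P.d i)
    ⟨s₀, hs₀, by rw [← LinearMap.comp_assoc, hs₀d]⟩ fun i ⟨s, hs, hsd⟩ => by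
      obtain ⟨σ, hσ, hσd⟩ := PreservesDegree.exists_lift (P.d_mem (i + 1))
        ((hφ (i + 1)).sub (hs.comp (P.d_mem i))) <| by
          rintro _ ⟨z, rfl⟩
          refine (P.exact_d i _).1 ?_
          rw [← LinearMap.comp_apply, LinearMap.comp_sub, hφd, hsd]
          exact sub_self _
      refine ⟨⟨σ, hσ, ?_⟩, hσd⟩
      rw [← LinearMap.comp_assoc, hσd, LinearMap.sub_comp, LinearMap.comp_assoc,
        (P.exact_d i).linearMap_comp_eq_zero, LinearMap.comp_zero]
      exact sub_zero (φ (i + 1) ∘ₗ P.d (i + 1))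
  exact ⟨fun i => (F i).1, fun i => (F i).2.1, by simpa only [hF₀] using hs₀d, hF⟩

end GradedAlgebra

theorem redD_mkQ (P : FreeResolution.{u, v, w} 𝒜) (i : ℕ) (z : P.gen (i + 1) →₀ R) :
    P.redD i ((mulAug 𝒜 _).mkQ z) = (mulAug 𝒜 _).mkQ (P.d i z) :=
  rfl

theorem mkQ_mem_boundaries (P : FreeResolution.{u, v, w} 𝒜) {i j : ℕ}
    {y : P.gen (i + 1) →₀ R} (hy : y ∈ freeDegree 𝒜 (P.deg (i + 1)) j) {z : P.gen i →₀ R}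
    (hyz : P.d i y - z ∈ mulAug 𝒜 (P.gen i →₀ R)) :
    (mulAug 𝒜 (P.gen i →₀ R)).mkQ z ∈ P.boundaries i j :=
  ⟨(mulAug 𝒜 _).mkQ y, ⟨y, hy, rfl⟩, by
    rw [redD_mkQ, Submodule.mkQ_apply, Submodule.mkQ_apply, Submodule.Quotient.eq]; exact hyz⟩

theorem subsingleton_tor [GradedAlgebra 𝒜] (P : FreeResolution.{u, v, w} 𝒜)
    (Q : FreeResolution.{u, v, w'} 𝒜) (hQ : ∀ i x, Q.deg i x = i) {i j : ℕ} (hij : j ≠ i) :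
    Subsingleton (P.Tor i j) := by
  obtain ⟨f, hf, hf₀, hfd⟩ := exists_chainMap P Q
  obtain ⟨g, hg, hg₀, hgd⟩ := exists_chainMap Q P
  obtain ⟨s, hs, hs₀, hsd⟩ := exists_homotopy P (φ := fun i => LinearMap.id - g i ∘ₗ f i)
    (fun i => .sub .id ((hg i).comp (hf i)))
    (by rw [LinearMap.comp_sub, ← LinearMap.comp_assoc, hg₀, hf₀, LinearMap.comp_id, sub_self])
    (fun i => by
      rw [LinearMap.comp_sub, LinearMap.sub_comp, ← LinearMap.comp_assoc, hgd, LinearMap.comp_assoc,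
        hfd, LinearMap.comp_assoc, LinearMap.comp_id, LinearMap.id_comp])
  have gf_mem : ∀ z ∈ freeDegree 𝒜 (P.deg i) j, g i (f i z) ∈ mulAug 𝒜 (P.gen i →₀ R) :=
    fun z hz => mulAug_le_comap 𝒜 (g i) (mem_mulAug_of_mem_freeDegree (hQ i) hij (hf i j z hz))
  suffices P.cycles i j ≤ P.boundaries i j by
    rwa [Submodule.Quotient.subsingleton_iff, Submodule.submoduleOf_eq_top]
  cases i with
  | zero =>
    rintro _ ⟨z, hz, rfl⟩
    refine P.mkQ_mem_boundaries (hs 0 j z hz) ?_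
    rw [← LinearMap.comp_apply, hs₀]
    simpa using gf_mem z hz
  | succ i =>
    rintro _ ⟨⟨z, hz, rfl⟩, hdz : (mulAug 𝒜 _).mkQ (P.d i z) = 0⟩
    rw [Submodule.mkQ_apply, Submodule.Quotient.mk_eq_zero] at hdz
    refine P.mkQ_mem_boundaries (hs (i + 1) j z hz) ?_
    rw [← LinearMap.comp_apply, hsd]
    convert neg_mem (add_mem (gf_mem z hz) (mulAug_le_comap 𝒜 (s i) hdz)) using 1
    simp only [LinearMap.sub_apply, LinearMap.id_apply, LinearMap.comp_apply]
    abel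

end FreeResolution

theorem IsStandard.isHomogeneousKoszul {𝒜 : ℕ → Submodule k R} (h𝒜 : IsStandard 𝒜)
    (P : FreeResolution.{u, v, v} 𝒜) (hP : ∀ i, Finite (P.gen i) ∧ ∀ x, P.deg i x = i) :
    IsHomogeneousKoszul 𝒜 := by
  let _ := h𝒜.isInternal.chooseDecomposition
  have := h𝒜.gradedMonoid
  let _ : GradedAlgebra 𝒜 := {}
  exact ⟨h𝒜, ⟨P, hP⟩, fun Q _ _ hij => Q.subsingleton_tor P (fun i => (hP i).2) hij⟩

/-! ### Ordered monomials in skew commuting elements -/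

section Exponents

variable {ι : Type*}

theorem exists_eq_add_single [DecidableEq ι] {a : ι → ℕ} {l : ι} (hl : a l ≠ 0) :
    ∃ c : ι → ℕ, a = c + Pi.single l 1 :=
  ⟨a - Pi.single l 1,
    (tsub_add_cancel_of_le fun t => by
      obtain rfl | ht := eq_or_ne t l <;> simp [*, Nat.one_le_iff_ne_zero]).symm⟩

theorem exponent_induction [Finite ι] [DecidableEq ι] {p : (ι → ℕ) → Prop} (zero : p 0)
    (add_single : ∀ a l, p a → p (a + Pi.single l 1)) (a : ι → ℕ) : p a := by
  have := Fintype.ofFinite ι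
  induction hm : ∑ i, a i generalizing a with
  | zero =>
    rwa [show a = 0 from funext fun i => Finset.sum_eq_zero_iff.1 hm i (Finset.mem_univ i)]
  | succ m ih =>
    obtain ⟨l, -, hl⟩ := Finset.exists_ne_zero_of_sum_ne_zero (hm.trans_ne m.succ_ne_zero)
    obtain ⟨c, rfl⟩ := exists_eq_add_single hl
    exact add_single c l (ih c (by simpa [Finset.sum_add_distrib] using hm))

/-- The exponent vector `a` of a monomial in which the variables indexed by `S` occur at most
once. -/
def SquarefreeOn (S : Set ι) (a : ι → ℕ) : Prop := ∀ i ∈ S, a i ≤ 1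

variable {S : Set ι} {a b : ι → ℕ}

theorem SquarefreeOn.of_le (hb : SquarefreeOn S b) (hab : a ≤ b) : SquarefreeOn S a :=
  fun i hi => (hab i).trans (hb i hi)

theorem squarefreeOn_add_single_iff [DecidableEq ι] {l : ι} :
    SquarefreeOn S (a + Pi.single l 1) ↔ SquarefreeOn S a ∧ (l ∈ S → a l = 0) := by
  refine ⟨fun h => ⟨h.of_le le_self_add, fun hl => by simpa using h l hl⟩, fun ⟨h, h₀⟩ i hi => ?_⟩
  obtain rfl | hil := eq_or_ne i l
  · simp [h₀ hi]
  · simpa [hil] using h i hi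

theorem squarefreeOn_add_single_add_single_iff [DecidableEq ι] {l j : ι} (hlj : l ≠ j)
    (hl : SquarefreeOn S (a + Pi.single l 1)) :
    SquarefreeOn S (a + Pi.single l 1 + Pi.single j 1) ↔ SquarefreeOn S (a + Pi.single j 1) := by
  simp only [squarefreeOn_add_single_iff (l := j), hl, hl.of_le le_self_add, Pi.add_apply,
    Pi.single_eq_of_ne hlj.symm, add_zero]

end Exponents

variable {n : ℕ}

/-- The elements `x i` commute up to the scalars `q i j`. -/
def SkewCommute (q : Fin n → Fin n → k) (x : Fin n → R) : Prop :=
  ∀ i j, x i * x j = q i j • (x j * x i)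

/-- The indices of the even variables; the squares of the others vanish. -/
def evenIndices (q : Fin n → Fin n → k) : Set (Fin n) := {i | q i i = 1}

/-- The scalar by which moving the variable `l` past the part of a monomial with exponents `a` that
precedes it multiplies the monomial. -/
def swapCoeff (p : Fin n → Fin n → k) (l : Fin n) (a : Fin n → ℕ) : k :=
  ∏ t ∈ Finset.Iio l, p l t ^ a t

section SwapCoeff

variable {p : Fin n → Fin n → k} {l t : Fin n} (a : Fin n → ℕ)

theorem swapCoeff_add_single_of_lt (htl : t < l) :
    swapCoeff p l (a + Pi.single t 1) = swapCoeff p l a * p l t := by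
  have hsingle : ∏ s ∈ Finset.Iio l, p l s ^ (Pi.single t 1 : Fin n → ℕ) s = p l t := by
    rw [Finset.prod_eq_single_of_mem t (Finset.mem_Iio.2 htl) fun s _ hs => by simp [hs]]
    simp
  simp only [swapCoeff, Pi.add_apply, pow_add, Finset.prod_mul_distrib, hsingle]

theorem swapCoeff_add_single_of_le (hlt : l ≤ t) :
    swapCoeff p l (a + Pi.single t 1) = swapCoeff p l a :=
  Finset.prod_congr rfl fun s hs => by simp [((Finset.mem_Iio.1 hs).trans_le hlt).ne]

variable {a}

theorem swapCoeff_eq_one (ha : ∀ t, t < l → a t = 0) : swapCoeff p l a = 1 :=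
  Finset.prod_eq_one fun t ht => by rw [ha t (Finset.mem_Iio.1 ht), pow_zero]

variable (l a) in
theorem swapCoeff_ne_zero (hp : ∀ i j, p i j ≠ 0) : swapCoeff p l a ≠ 0 :=
  Finset.prod_ne_zero_iff.2 fun _ _ => pow_ne_zero _ (hp _ _)

variable (a) in
theorem swapCoeff_mul_swapCoeff_add_single {q : Fin n → Fin n → k} (hq : ∀ i j, q i j * q j i = 1)
    {i j : Fin n} (hij : i ≠ j) :
    swapCoeff q j a * swapCoeff q i (a + Pi.single j 1) =
      q i j * (swapCoeff q i a * swapCoeff q j (a + Pi.single i 1)) := by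
  obtain h | h := lt_or_gt_of_ne hij
  · rw [swapCoeff_add_single_of_le _ h.le, swapCoeff_add_single_of_lt _ h]
    linear_combination (-(swapCoeff q i a * swapCoeff q j a)) * hq i j
  · rw [swapCoeff_add_single_of_le _ h.le, swapCoeff_add_single_of_lt _ h]
    ring

end SwapCoeff

/-- The monomial `x 0 ^ a 0 * x 1 ^ a 1 * ⋯`. -/
def orderedMonomial (x : Fin n → R) (a : Fin n → ℕ) : R :=
  ((List.finRange n).map fun i => x i ^ a i).prod

theorem orderedMonomial_zero (x : Fin n → R) : orderedMonomial x 0 = 1 := by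
  simp [orderedMonomial]

/-- The exponents of the ordered monomials in skew commuting elements which do not vanish for
trivial reasons. -/
abbrev PBWIndex (q : Fin n → Fin n → k) : Type := {a : Fin n → ℕ // SquarefreeOn (evenIndices q)ᶜ a}

variable {q : Fin n → Fin n → k} {x : Fin n → R}

namespace SkewCommute

theorem mul_self_eq_zero (hx : SkewCommute q x) {i : Fin n} (hi : i ∉ evenIndices q) :
    x i * x i = 0 := by
  have h : (1 - q i i) • (x i * x i) = 0 := by rw [sub_smul, one_smul, ← hx, sub_self]
  exact (smul_eq_zero.1 h).resolve_left (sub_ne_zero.2 (Ne.symm hi))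

theorem orderedMonomial_eq_zero (hx : SkewCommute q x) {a : Fin n → ℕ}
    (ha : ¬SquarefreeOn (evenIndices q)ᶜ a) : orderedMonomial x a = 0 := by
  simp only [SquarefreeOn, not_forall, not_le] at ha
  obtain ⟨i, hi, hai⟩ := ha
  refine List.prod_eq_zero (List.mem_map.2 ⟨i, List.mem_finRange i, ?_⟩)
  exact pow_eq_zero_of_le hai (by rw [pow_two, hx.mul_self_eq_zero hi])

theorem mul_pow_comm (hx : SkewCommute q x) (i j : Fin n) (m : ℕ) :
    x i * x j ^ m = q i j ^ m • (x j ^ m * x i) := by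
  induction m with
  | zero => simp
  | succ m ih =>
    rw [pow_succ, ← mul_assoc, ih, smul_mul_assoc, mul_assoc, hx i j, mul_smul_comm, smul_smul,
      ← mul_assoc, pow_succ]

theorem mul_list_prod (hx : SkewCommute q x) {l : Fin n} (a : Fin n → ℕ) {s : List (Fin n)}
    (hs : s.Pairwise (· < ·)) (hl : l ∈ s) :
    x l * (s.map fun i => x i ^ a i).prod =
      (s.map fun t => if t < l then q l t ^ a t else 1).prod •
        (s.map fun i => x i ^ (a + Pi.single l 1 : Fin n → ℕ) i).prod := by
  induction s with
  | nil => simp at hl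
  | cons i s ih =>
    obtain ⟨his, hs⟩ := List.pairwise_cons.1 hs
    simp only [List.map_cons, List.prod_cons]
    obtain rfl | hl := List.mem_cons.1 hl
    · have hcoeff : (s.map fun t => if t < l then q l t ^ a t else 1) = s.map fun _ => 1 :=
        List.map_congr_left fun t ht => if_neg (his t ht).not_gt
      have htail : (s.map fun i => x i ^ (a + Pi.single l 1 : Fin n → ℕ) i) =
          s.map fun i => x i ^ a i :=
        List.map_congr_left fun t ht => by simp [(his t ht).ne']
      rw [hcoeff, htail, ← mul_assoc]
      simp [pow_succ']
    · rw [← mul_assoc, hx.mul_pow_comm, smul_mul_assoc, mul_assoc, ih hs hl, mul_smul_comm,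
        smul_smul, if_pos (his l hl)]
      simp [(his l hl).ne]

theorem mul_orderedMonomial (hx : SkewCommute q x) (l : Fin n) (a : Fin n → ℕ) :
    x l * orderedMonomial x a = swapCoeff q l a • orderedMonomial x (a + Pi.single l 1) := by
  rw [orderedMonomial, hx.mul_list_prod a (List.pairwise_lt_finRange n) (List.mem_finRange l),
    swapCoeff, ← Finset.filter_gt_eq_Iio, Finset.prod_filter, Fin.prod_univ_def, orderedMonomial]

theorem mul_mem_span_orderedMonomial (hx : SkewCommute q x) (l : Fin n) {s : R}
    (hs : s ∈ Submodule.span k (Set.range (orderedMonomial x))) :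
    x l * s ∈ Submodule.span k (Set.range (orderedMonomial x)) := by
  rw [← LinearMap.mulLeft_apply (R := k), ← Submodule.mem_comap]
  refine Submodule.span_le.2 ?_ hs
  rintro _ ⟨a, rfl⟩
  rw [SetLike.mem_coe, Submodule.mem_comap, LinearMap.mulLeft_apply, hx.mul_orderedMonomial]
  exact Submodule.smul_mem _ _ (Submodule.subset_span ⟨_, rfl⟩)

theorem span_orderedMonomial (hx : SkewCommute q x)
    (hgen : Algebra.adjoin k (Set.range x) = ⊤) :
    Submodule.span k (Set.range (orderedMonomial x)) = ⊤ := by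
  set S := Submodule.span k (Set.range (orderedMonomial x))
  have hmul (r : R) : ∀ s ∈ S, r * s ∈ S := by
    have hr : r ∈ Algebra.adjoin k (Set.range x) := hgen ▸ Algebra.mem_top
    induction hr using Algebra.adjoin_induction with
    | mem r hr =>
      obtain ⟨l, rfl⟩ := hr
      exact fun s => hx.mul_mem_span_orderedMonomial l
    | algebraMap c => exact fun s hs => by rw [← Algebra.smul_def]; exact S.smul_mem c hs
    | add r t _ _ hr ht => exact fun s hs => by rw [add_mul]; exact add_mem (hr s hs) (ht s hs)
    | mul r t _ _ hr ht => exact fun s hs => by rw [mul_assoc]; exact hr _ (ht s hs)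
  have hone : (1 : R) ∈ S := Submodule.subset_span ⟨0, orderedMonomial_zero x⟩
  exact Submodule.eq_top_iff'.2 fun r => by simpa only [mul_one] using hmul r 1 hone

theorem span_orderedMonomial_pbwIndex (hx : SkewCommute q x)
    (hgen : Algebra.adjoin k (Set.range x) = ⊤) :
    Submodule.span k (Set.range fun a : PBWIndex q => orderedMonomial x a) = ⊤ := by
  rw [eq_top_iff, ← hx.span_orderedMonomial hgen, Submodule.span_le]
  rintro _ ⟨a, rfl⟩
  by_cases ha : SquarefreeOn (evenIndices q)ᶜ a
  · exact Submodule.subset_span ⟨⟨a, ha⟩, rfl⟩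
  · rw [hx.orderedMonomial_eq_zero ha]
    exact zero_mem _

/-- The Poincaré–Birkhoff–Witt basis of an algebra generated by skew commuting elements, provided
that the ordered monomials are linearly independent. -/
noncomputable def monomialBasis (hx : SkewCommute q x) (hgen : Algebra.adjoin k (Set.range x) = ⊤)
    (hli : LinearIndependent k fun a : PBWIndex q => orderedMonomial x a) :
    Module.Basis (PBWIndex q) k R :=
  .mk hli (hx.span_orderedMonomial_pbwIndex hgen).ge

theorem monomialBasis_apply (hx : SkewCommute q x) (hgen : Algebra.adjoin k (Set.range x) = ⊤)
    (hli : LinearIndependent k fun a : PBWIndex q => orderedMonomial x a) (a : PBWIndex q) :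
    hx.monomialBasis hgen hli a = orderedMonomial x a :=
  Module.Basis.mk_apply _ _ _

end SkewCommute

/-! ### The regular representation -/

open Classical in
/-- The formal monomial with exponents `a`, subject to the vanishing of the squares of the variables
indexed by `S`. -/
noncomputable def formalMonomial (k : Type*) [Field k] (S : Set (Fin n)) (a : Fin n → ℕ) :
    (Fin n → ℕ) →₀ k :=
  if SquarefreeOn S a then Finsupp.single a 1 else 0

/-- Left multiplication by the `l`-th variable on formal ordered monomials. -/
noncomputable def regularRep (q : Fin n → Fin n → k) (l : Fin n) :
    Module.End k ((Fin n → ℕ) →₀ k) :=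
  Finsupp.linearCombination k fun a =>
    swapCoeff q l a • formalMonomial k (evenIndices q)ᶜ (a + Pi.single l 1)

theorem regularRep_single (l : Fin n) (a : Fin n → ℕ) :
    regularRep q l (Finsupp.single a 1) =
      swapCoeff q l a • formalMonomial k (evenIndices q)ᶜ (a + Pi.single l 1) := by
  rw [regularRep, Finsupp.linearCombination_single, one_smul]

theorem regularRep_formalMonomial (l : Fin n) (a : Fin n → ℕ) :
    regularRep q l (formalMonomial k (evenIndices q)ᶜ a) =
      swapCoeff q l a • formalMonomial k (evenIndices q)ᶜ (a + Pi.single l 1) := by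
  by_cases ha : SquarefreeOn (evenIndices q)ᶜ a
  · rw [formalMonomial, if_pos ha, regularRep_single]
  · have hal : ¬SquarefreeOn (evenIndices q)ᶜ (a + Pi.single l 1) :=
      fun h => ha (h.of_le le_self_add)
    rw [formalMonomial, if_neg ha, formalMonomial, if_neg hal, map_zero, smul_zero]

theorem skewCommute_regularRep (hq : ∀ i j, q i j * q j i = 1) : SkewCommute q (regularRep q) := by
  intro i j
  refine Finsupp.lhom_ext' fun a => LinearMap.ext_ring ?_
  simp only [LinearMap.comp_apply, Finsupp.lsingle_apply, Module.End.mul_apply,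
    LinearMap.smul_apply, regularRep_single, map_smul, regularRep_formalMonomial, smul_smul]
  rw [add_right_comm]
  obtain rfl | hij := eq_or_ne i j
  · by_cases hi : i ∈ evenIndices q
    · rw [show q i i = 1 from hi, one_mul]
    · have hai : ¬SquarefreeOn (evenIndices q)ᶜ (a + Pi.single i 1 + Pi.single i 1) := fun h => by
        simpa using h i hi
      rw [formalMonomial, if_neg hai, smul_zero, smul_zero]
  · rw [swapCoeff_mul_swapCoeff_add_single a hq hij]

theorem SkewCommute.map_orderedMonomial_formalMonomial_zero (hx : SkewCommute q x)
    (hq : ∀ i j, q i j ≠ 0) {ρ : R →ₐ[k] Module.End k ((Fin n → ℕ) →₀ k)}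
    (hρ : ∀ l, ρ (x l) = regularRep q l) (a : Fin n → ℕ) :
    ρ (orderedMonomial x a) (formalMonomial k (evenIndices q)ᶜ 0) =
      formalMonomial k (evenIndices q)ᶜ a := by
  induction a using exponent_induction with
  | zero => rw [orderedMonomial_zero, map_one, Module.End.one_apply]
  | add_single a l ih =>
    refine smul_right_injective _ (swapCoeff_ne_zero l a hq) ?_
    dsimp only
    rw [← regularRep_formalMonomial, ← ih, ← hρ, ← Module.End.mul_apply, ← map_mul,
      hx.mul_orderedMonomial, map_smul, LinearMap.smul_apply]

theorem SkewCommute.linearIndependent_orderedMonomial (hx : SkewCommute q x)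
    (hq : ∀ i j, q i j ≠ 0) {ρ : R →ₐ[k] Module.End k ((Fin n → ℕ) →₀ k)}
    (hρ : ∀ l, ρ (x l) = regularRep q l) :
    LinearIndependent k fun a : PBWIndex q => orderedMonomial x a := by
  refine LinearIndependent.of_comp
    (LinearMap.applyₗ (formalMonomial k (evenIndices q)ᶜ 0) ∘ₗ ρ.toLinearMap) ?_
  convert (Finsupp.linearIndependent_single_one k (Fin n → ℕ)).comp _ Subtype.val_injective
    using 1
  ext1 a
  exact (hx.map_orderedMonomial_formalMonomial_zero hq hρ a).trans (if_pos a.2)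

/-! ### The Koszul complex -/

/-- The generators of the `i`-th module of the Koszul complex: the monomials of degree `i` in dual
variables, in which the even ones occur at most once. -/
@[ext]
structure KoszulGen (q : Fin n → Fin n → k) (i : ℕ) : Type v where
  /-- the exponents of the monomial -/
  exponent : Fin n → ℕ
  squarefreeOn : SquarefreeOn (evenIndices q) exponent
  sum_eq : ∑ l, exponent l = i

instance (q : Fin n → Fin n → k) (i : ℕ) : Finite (KoszulGen.{u, v} q i) := by
  have hle (b : KoszulGen.{u, v} q i) : b.exponent ≤ fun _ => i := fun l =>
    (Finset.single_le_sum (fun _ _ => Nat.zero_le _) (Finset.mem_univ l)).trans_eq b.sum_eq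
  have := (Set.finite_Iic (fun _ : Fin n => i)).to_subtype
  exact Finite.of_injective (fun b => (⟨b.exponent, hle b⟩ : Set.Iic fun _ => i))
    fun b c hbc => KoszulGen.ext (congrArg Subtype.val hbc)

instance (q : Fin n → Fin n → k) : Unique (KoszulGen.{u, v} q 0) where
  default := ⟨0, fun _ _ => Nat.zero_le _, by simp⟩
  uniq b := KoszulGen.ext (funext fun l => Finset.sum_eq_zero_iff.1 b.sum_eq l (Finset.mem_univ l))

/-- The `i`-th module of the Koszul complex. -/
abbrev KoszulModule (q : Fin n → Fin n → k) (R : Type v) [Ring R] (i : ℕ) : Type v :=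
  KoszulGen.{u, v} q i →₀ R

open Classical in
/-- The multiple by `r` of the generator with exponents `b`, or zero if there is none. -/
noncomputable def koszulTerm (q : Fin n → Fin n → k) (i : ℕ) (b : Fin n → ℕ) :
    R →ₗ[k] KoszulModule q R i :=
  if h : SquarefreeOn (evenIndices q) b ∧ ∑ l, b l = i then Finsupp.lsingle ⟨b, h.1, h.2⟩ else 0

variable {i : ℕ} {b : Fin n → ℕ}

theorem koszulTerm_exponent (b : KoszulGen.{u, v} q i) (r : R) :
    koszulTerm q i b.exponent r = Finsupp.single b r := by
  rw [koszulTerm, dif_pos ⟨b.squarefreeOn, b.sum_eq⟩]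
  rfl

theorem koszulTerm_of_not_squarefreeOn (hb : ¬SquarefreeOn (evenIndices q) b) (r : R) :
    koszulTerm q i b r = 0 := by
  rw [koszulTerm, dif_neg fun h => hb h.1, LinearMap.zero_apply]

theorem koszulTerm_of_sum_ne (hb : ∑ l, b l ≠ i) (r : R) : koszulTerm q i b r = 0 := by
  rw [koszulTerm, dif_neg fun h => hb h.2, LinearMap.zero_apply]

theorem koszulTerm_cases {p : (Fin n → ℕ) → (R →ₗ[k] KoszulModule q R i) → Prop}
    (exponent : ∀ b : KoszulGen.{u, v} q i, p b.exponent (Finsupp.lsingle b))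
    (zero : ∀ b, p b 0) (b : Fin n → ℕ) : p b (koszulTerm q i b) := by
  rw [koszulTerm]
  split_ifs with h
  · exact exponent ⟨b, h.1, h.2⟩
  · exact zero b

theorem op_smul_koszulTerm (b : Fin n → ℕ) (r s : R) :
    op s • koszulTerm q i b r = koszulTerm q i b (r * s) := by
  induction b using koszulTerm_cases (R := R) (q := q) (i := i) <;> simp

theorem smul_koszulTerm (b : Fin n → ℕ) (r s : R) :
    s • koszulTerm q i b r = koszulTerm q i b (s * r) := by
  induction b using koszulTerm_cases (R := R) (q := q) (i := i) <;> simp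

theorem koszulTerm_mem_freeDegree {𝒜 : ℕ → Submodule k R} {r : R} {j : ℕ} (hr : r ∈ 𝒜 j) :
    koszulTerm q i b r ∈ freeDegree 𝒜 (fun _ => i) (i + j) := by
  induction b using koszulTerm_cases (R := R) (q := q) (i := i) with
  | exponent b => exact single_mem_freeDegree hr (fun _ => i) b
  | zero _ => exact zero_mem _

theorem koszulModule_induction {p : KoszulModule q R i → Prop} (z : KoszulModule q R i)
    (koszulTerm : ∀ b r, SquarefreeOn (evenIndices q) b → p (koszulTerm q i b r))
    (add : ∀ y z, p y → p z → p (y + z)) : p z := by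
  induction z using Finsupp.induction_linear with
  | zero => simpa using koszulTerm 0 0 fun _ _ => Nat.zero_le _
  | add y z hy hz => exact add y z hy hz
  | single b r => simpa only [koszulTerm_exponent] using koszulTerm b.exponent r b.squarefreeOn

/-- The skew derivation of the Koszul complex with respect to the `l`-th dual variable. It removes
a single copy of this variable without the factor `b l`, so that the powers of the odd variables
behave like divided powers. -/
noncomputable def contraction (q : Fin n → Fin n → k) (i : ℕ) (l : Fin n) :
    KoszulModule q R (i + 1) →ₗ[Rᵐᵒᵖ] KoszulModule q R i :=
  freeLift fun b =>
    if b.exponent l = 0 then 0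
    else swapCoeff (-q) l b.exponent • koszulTerm q i (b.exponent - Pi.single l 1) 1

section Contraction

variable {l t j : Fin n} (r : R)

theorem contraction_koszulTerm_of_eq_zero (hl : b l = 0) :
    contraction q i l (koszulTerm q (i + 1) b r) = 0 := by
  induction b using koszulTerm_cases (R := R) (q := q) (i := i + 1) with
  | exponent b => rw [Finsupp.lsingle_apply, contraction, freeLift_single, if_pos hl, smul_zero]
  | zero b => rw [LinearMap.zero_apply, map_zero]

theorem contraction_koszulTerm_add_single
    (hb : SquarefreeOn (evenIndices q) (b + Pi.single l 1)) :
    contraction q i l (koszulTerm q (i + 1) (b + Pi.single l 1) r) =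
      swapCoeff (-q) l b • koszulTerm q i b r := by
  have hsum : ∑ t, (b + Pi.single l 1 : Fin n → ℕ) t = ∑ t, b t + 1 := by
    simp [Finset.sum_add_distrib]
  by_cases hi : ∑ t, b t = i
  · rw [koszulTerm, dif_pos ⟨hb, by rw [hsum, hi]⟩, Finsupp.lsingle_apply, contraction,
      freeLift_single, if_neg (by simp), add_tsub_cancel_right, swapCoeff_add_single_of_le _ le_rfl,
      smul_comm, op_smul_koszulTerm, one_mul]
  · rw [koszulTerm_of_sum_ne hi, koszulTerm_of_sum_ne (by rw [hsum]; simpa using hi), map_zero,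
      smul_zero]

theorem contraction_koszulTerm_add_single_of_ne (hlj : l ≠ j)
    (hb : SquarefreeOn (evenIndices q) (b + Pi.single l 1)) :
    contraction q i l (koszulTerm q (i + 1) (b + Pi.single l 1 + Pi.single j 1) r) =
      swapCoeff (-q) l (b + Pi.single j 1) • koszulTerm q i (b + Pi.single j 1) r := by
  by_cases hbj : SquarefreeOn (evenIndices q) (b + Pi.single l 1 + Pi.single j 1)
  · rw [add_right_comm] at hbj ⊢
    exact contraction_koszulTerm_add_single r hbj
  · rw [koszulTerm_of_not_squarefreeOn hbj, koszulTerm_of_not_squarefreeOn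
      (mt (squarefreeOn_add_single_add_single_iff hlj hb).2 hbj), map_zero, smul_zero]

theorem contraction_smul (z : KoszulModule q R (i + 1)) :
    contraction q i l (r • z) = r • contraction q i l z := by
  induction z using koszulModule_induction with
  | add y z hy hz => rw [smul_add, map_add, hy, hz, map_add, smul_add]
  | koszulTerm b s hb =>
    rw [smul_koszulTerm]
    by_cases hl : b l = 0
    · rw [contraction_koszulTerm_of_eq_zero _ hl, contraction_koszulTerm_of_eq_zero _ hl, smul_zero]
    · obtain ⟨c, rfl⟩ := exists_eq_add_single hl
      rw [contraction_koszulTerm_add_single _ hb, contraction_koszulTerm_add_single _ hb,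
        smul_comm r, smul_koszulTerm]

theorem contraction_contraction_of_lt (hlt : l < t) (z : KoszulModule q R (i + 1 + 1)) :
    contraction q i l (contraction q (i + 1) t z) =
      -q t l • contraction q i t (contraction q (i + 1) l z) := by
  induction z using koszulModule_induction with
  | add y z hy hz => simp only [map_add, hy, hz, smul_add]
  | koszulTerm b s hb =>
    by_cases hl : b l = 0
    · rw [contraction_koszulTerm_of_eq_zero _ hl, map_zero, smul_zero]
      by_cases ht : b t = 0
      · rw [contraction_koszulTerm_of_eq_zero _ ht, map_zero]
      · obtain ⟨c, rfl⟩ := exists_eq_add_single ht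
        rw [contraction_koszulTerm_add_single _ hb, LinearMap.map_smul_of_tower,
          contraction_koszulTerm_of_eq_zero _ (by simpa [hlt.ne] using hl), smul_zero]
    obtain ⟨c, rfl⟩ := exists_eq_add_single hl
    rw [contraction_koszulTerm_add_single _ hb, LinearMap.map_smul_of_tower]
    by_cases ht : c t = 0
    · rw [contraction_koszulTerm_of_eq_zero _ (by simpa [hlt.ne'] using ht),
        contraction_koszulTerm_of_eq_zero _ ht, map_zero, smul_zero, smul_zero]
    obtain ⟨b, rfl⟩ := exists_eq_add_single ht
    rw [contraction_koszulTerm_add_single _ (hb.of_le le_self_add), add_right_comm b]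
    rw [add_right_comm] at hb
    rw [contraction_koszulTerm_add_single _ hb, LinearMap.map_smul_of_tower,
      contraction_koszulTerm_add_single _ (hb.of_le le_self_add), smul_smul, smul_smul, smul_smul,
      swapCoeff_add_single_of_lt _ hlt, swapCoeff_add_single_of_le _ hlt.le, Pi.neg_apply,
      Pi.neg_apply]
    congr 1
    ring

theorem contraction_contraction_self (hl : l ∈ evenIndices q) (z : KoszulModule q R (i + 1 + 1)) :
    contraction q i l (contraction q (i + 1) l z) = 0 := by
  induction z using koszulModule_induction with
  | add y z hy hz => rw [map_add, map_add, hy, hz, add_zero]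
  | koszulTerm b s hb =>
    by_cases hbl : b l = 0
    · rw [contraction_koszulTerm_of_eq_zero _ hbl, map_zero]
    · obtain ⟨c, rfl⟩ := exists_eq_add_single hbl
      rw [contraction_koszulTerm_add_single _ hb, LinearMap.map_smul_of_tower,
        contraction_koszulTerm_of_eq_zero _ ((squarefreeOn_add_single_iff.1 hb).2 hl), smul_zero]

end Contraction

/-- The differential of the Koszul complex of the elements `x`. -/
noncomputable def koszulD (q : Fin n → Fin n → k) (x : Fin n → R) (i : ℕ) :
    KoszulModule q R (i + 1) →ₗ[Rᵐᵒᵖ] KoszulModule q R i :=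
  ∑ l, x l • contraction q i l

theorem koszulD_apply (x : Fin n → R) (z : KoszulModule q R (i + 1)) :
    koszulD q x i z = ∑ l, x l • contraction q i l z := by
  simp [koszulD]

theorem sum_sum_eq_zero_of_antisymm {ι M : Type*} [Fintype ι] [LinearOrder ι] [AddCommGroup M]
    {F : ι → ι → M} (hdiag : ∀ l, F l l = 0) (hlt : ∀ l t, l < t → F l t + F t l = 0) :
    ∑ l, ∑ t, F l t = 0 := by
  have hsymm (l t : ι) : F l t + F t l = 0 := by
    obtain h | rfl | h := lt_trichotomy l t
    · exact hlt l t h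
    · rw [hdiag, add_zero]
    · rw [add_comm, hlt t l h]
  rw [← Fintype.sum_prod_type']
  refine Finset.sum_involution (fun p _ => p.swap) (fun p _ => hsymm p.1 p.2)
    (fun p _ hp h => hp ?_) (fun _ _ => Finset.mem_univ _) fun _ _ => Prod.swap_swap _
  rw [show p.2 = p.1 from congrArg Prod.fst h, hdiag]

theorem SkewCommute.koszulD_koszulD {x : Fin n → R} (hx : SkewCommute q x)
    (z : KoszulModule q R (i + 1 + 1)) : koszulD q x i (koszulD q x (i + 1) z) = 0 := by
  simp only [koszulD_apply, map_sum, contraction_smul]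
  refine sum_sum_eq_zero_of_antisymm (fun l => ?_) fun l t hlt => ?_
  · by_cases hl : l ∈ evenIndices q
    · rw [contraction_contraction_self hl, smul_zero, smul_zero]
    · rw [smul_smul, hx.mul_self_eq_zero hl, zero_smul]
  · rw [contraction_contraction_of_lt hlt, smul_smul, smul_smul, hx t l, smul_assoc, neg_smul,
      smul_neg, smul_comm (x l * x t), add_neg_cancel]

theorem preservesDegree_koszulD {𝒜 : ℕ → Submodule k R} [SetLike.GradedMonoid 𝒜] {x : Fin n → R}
    (hx : ∀ l, x l ∈ 𝒜 1) :
    PreservesDegree 𝒜 (fun _ => i + 1) (fun _ => i) (koszulD q x i) := by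
  refine .of_single_one fun b => ?_
  rw [koszulD_apply]
  refine sum_mem fun l _ => ?_
  rw [contraction, freeLift_single, op_one, one_smul]
  split_ifs
  · rw [smul_zero]
    exact zero_mem _
  · rw [smul_comm, smul_koszulTerm, mul_one]
    exact Submodule.smul_mem _ _ (koszulTerm_mem_freeDegree (hx l))

/-! ### The contracting homotopy -/

section Homotopy

open Function

variable {B : Module.Basis (PBWIndex q) k R} {a m : Fin n → ℕ} {l j : Fin n}

theorem exists_isLeast_support (hm : m ≠ 0) : ∃ j, IsLeast (support m) j := by
  obtain ⟨j, hj⟩ := (Set.toFinite (support m)).exists_minimal (support_nonempty_iff.2 hm)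
  exact ⟨j, hj.1, fun t ht => (le_total t j).elim (hj.2 ht) id⟩

open Classical in
/-- The contracting homotopy of the Koszul complex, in terms of a basis `B` of ordered monomials. If
the first variable occurring in `orderedMonomial x a` or in the generator with exponents `b` occurs
in the monomial, then the homotopy moves one copy of it from the monomial to the generator. -/
noncomputable def koszulHomotopy (x : Fin n → R) (B : Module.Basis (PBWIndex q) k R) (i : ℕ) :
    KoszulModule q R i →ₗ[k] KoszulModule q R (i + 1) :=
  Finsupp.lsum k fun b => B.constr k fun a =>
    ∑ j, if IsLeast (support (a.1 + b.exponent)) j ∧ a.1 j ≠ 0 then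
      koszulTerm q (i + 1) (b.exponent + Pi.single j 1) (orderedMonomial x (a.1 - Pi.single j 1))
    else 0

theorem koszulHomotopy_koszulTerm (hB : ∀ a, B a = orderedMonomial x a)
    (ha : SquarefreeOn (evenIndices q)ᶜ a) (hj : IsLeast (support (a + b)) j) :
    koszulHomotopy x B i (koszulTerm q i b (orderedMonomial x a)) =
      if a j = 0 then 0
      else koszulTerm q (i + 1) (b + Pi.single j 1) (orderedMonomial x (a - Pi.single j 1)) := by
  by_cases hb : SquarefreeOn (evenIndices q) b ∧ ∑ l, b l = i
  · rw [koszulTerm, dif_pos hb, Finsupp.lsingle_apply, koszulHomotopy, Finsupp.lsum_single,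
      ← hB ⟨a, ha⟩, B.constr_basis, Finset.sum_eq_single_of_mem j (Finset.mem_univ j)
        fun t _ ht => if_neg fun h => ht (h.1.unique hj)]
    simp only [hj, true_and, ne_eq, ite_not]
  · have hbj : ¬(SquarefreeOn (evenIndices q) (b + Pi.single j 1) ∧
        ∑ l, (b + Pi.single j 1 : Fin n → ℕ) l = i + 1) := fun h =>
      hb ⟨h.1.of_le le_self_add, by simpa [Finset.sum_add_distrib] using h.2⟩
    rw [koszulTerm, dif_neg hb, koszulTerm, dif_neg hbj, LinearMap.zero_apply,
      LinearMap.zero_apply, map_zero, ite_self]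

theorem koszulHomotopy_koszulTerm_add_single (hB : ∀ a, B a = orderedMonomial x a)
    (ha : SquarefreeOn (evenIndices q)ᶜ (a + Pi.single j 1)) (hm : a + Pi.single j 1 + b = m)
    (hj : IsLeast (support m) j) :
    koszulHomotopy x B i (koszulTerm q i b (orderedMonomial x (a + Pi.single j 1))) =
      koszulTerm q (i + 1) (b + Pi.single j 1) (orderedMonomial x a) := by
  rw [koszulHomotopy_koszulTerm hB ha (hm ▸ hj), if_neg (by simp), add_tsub_cancel_right]

namespace SkewCommute

variable (hx : SkewCommute q x) (hB : ∀ a, B a = orderedMonomial x a)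
include hx hB

theorem koszulHomotopy_koszulTerm_of_eq_zero (haj : a j = 0) (hm : a + b = m)
    (hj : IsLeast (support m) j) :
    koszulHomotopy x B i (koszulTerm q i b (orderedMonomial x a)) = 0 := by
  by_cases ha : SquarefreeOn (evenIndices q)ᶜ a
  · rw [koszulHomotopy_koszulTerm hB ha (hm ▸ hj), if_pos haj]
  · rw [hx.orderedMonomial_eq_zero ha, map_zero, map_zero]

theorem koszulHomotopy_koszulTerm_add_single_of_ne (hlj : l ≠ j)
    (ha : SquarefreeOn (evenIndices q)ᶜ (a + Pi.single j 1))
    (hm : a + Pi.single l 1 + Pi.single j 1 + b = m) (hj : IsLeast (support m) j) :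
    koszulHomotopy x B i
        (koszulTerm q i b (orderedMonomial x (a + Pi.single l 1 + Pi.single j 1))) =
      koszulTerm q (i + 1) (b + Pi.single j 1) (orderedMonomial x (a + Pi.single l 1)) := by
  by_cases hal : SquarefreeOn (evenIndices q)ᶜ (a + Pi.single l 1 + Pi.single j 1)
  · exact koszulHomotopy_koszulTerm_add_single hB hal hm hj
  · have hal' := mt (fun h => (add_right_comm a _ _ ▸
      (squarefreeOn_add_single_add_single_iff hlj.symm ha).2 h)) hal
    rw [hx.orderedMonomial_eq_zero hal, hx.orderedMonomial_eq_zero hal', map_zero, map_zero,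
      map_zero]

omit hB in
theorem smul_contraction_koszulTerm (hb : SquarefreeOn (evenIndices q) (b + Pi.single l 1)) :
    x l • contraction q i l (koszulTerm q (i + 1) (b + Pi.single l 1) (orderedMonomial x a)) =
      (swapCoeff (-q) l b * swapCoeff q l a) •
        koszulTerm q i b (orderedMonomial x (a + Pi.single l 1)) := by
  rw [contraction_koszulTerm_add_single _ hb, smul_comm (x l), smul_koszulTerm,
    hx.mul_orderedMonomial, map_smul, smul_smul]

omit hB in
theorem smul_contraction_koszulTerm_of_ne (hlj : l ≠ j)
    (hb : SquarefreeOn (evenIndices q) (b + Pi.single l 1)) :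
    x l • contraction q i l
        (koszulTerm q (i + 1) (b + Pi.single l 1 + Pi.single j 1) (orderedMonomial x a)) =
      (swapCoeff (-q) l (b + Pi.single j 1) * swapCoeff q l a) •
        koszulTerm q i (b + Pi.single j 1) (orderedMonomial x (a + Pi.single l 1)) := by
  rw [contraction_koszulTerm_add_single_of_ne _ hlj hb, smul_comm (x l), smul_koszulTerm,
    hx.mul_orderedMonomial, map_smul, smul_smul]

theorem contraction_homotopy_of_ne (hlj : l ≠ j) (ha : SquarefreeOn (evenIndices q)ᶜ a)
    (hb : SquarefreeOn (evenIndices q) b) (hm : a + b = m) (hj : IsLeast (support m) j) :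
    x l • contraction q (i + 1) l
        (koszulHomotopy x B (i + 1) (koszulTerm q (i + 1) b (orderedMonomial x a))) +
      koszulHomotopy x B i
        (x l • contraction q i l (koszulTerm q (i + 1) b (orderedMonomial x a))) = 0 := by
  by_cases hbl : b l = 0
  · rw [contraction_koszulTerm_of_eq_zero _ hbl, smul_zero, map_zero, add_zero,
      koszulHomotopy_koszulTerm hB ha (hm ▸ hj)]
    split_ifs
    · rw [map_zero, smul_zero]
    · rw [contraction_koszulTerm_of_eq_zero _ (by simp [hbl, hlj]), smul_zero]
  have hjl : j < l := lt_of_le_of_ne (hj.2 (by simp [← hm, hbl])) hlj.symm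
  obtain ⟨c, rfl⟩ := exists_eq_add_single hbl
  rw [hx.smul_contraction_koszulTerm hb, map_smul]
  by_cases haj : a j = 0
  · rw [hx.koszulHomotopy_koszulTerm_of_eq_zero hB haj hm hj,
      hx.koszulHomotopy_koszulTerm_of_eq_zero hB (by simp [haj, hlj.symm]) (by rw [← hm]; abel) hj,
      map_zero, smul_zero, smul_zero, add_zero]
  obtain ⟨d, rfl⟩ := exists_eq_add_single haj
  rw [koszulHomotopy_koszulTerm_add_single hB ha hm hj,
    hx.smul_contraction_koszulTerm_of_ne hlj hb, add_right_comm d,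
    hx.koszulHomotopy_koszulTerm_add_single_of_ne hB hlj ha (by rw [← hm]; abel) hj, ← add_smul,
    swapCoeff_add_single_of_lt _ hjl, swapCoeff_add_single_of_lt _ hjl, Pi.neg_apply, Pi.neg_apply]
  convert zero_smul k _ using 2
  ring

theorem smul_contraction_koszulHomotopy_lead (haj : a j ≠ 0)
    (ha : SquarefreeOn (evenIndices q)ᶜ a) (hbj : SquarefreeOn (evenIndices q) (b + Pi.single j 1))
    (hm : a + b = m) (hj : IsLeast (support m) j) :
    x j • contraction q i j (koszulHomotopy x B i (koszulTerm q i b (orderedMonomial x a))) =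
      koszulTerm q i b (orderedMonomial x a) := by
  obtain ⟨d, rfl⟩ := exists_eq_add_single haj
  have hlow (t : Fin n) (ht : t < j) : d t = 0 ∧ b t = 0 := by
    have := notMem_support.1 (mt (@hj.2 t) ht.not_ge)
    simpa [← hm, ht.ne] using this
  rw [koszulHomotopy_koszulTerm_add_single hB ha hm hj, hx.smul_contraction_koszulTerm hbj,
    swapCoeff_eq_one fun t ht => (hlow t ht).2, swapCoeff_eq_one fun t ht => (hlow t ht).1, one_mul,
    one_smul]

theorem koszulHomotopy_smul_contraction_lead (hbj : b j ≠ 0)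
    (haj : SquarefreeOn (evenIndices q)ᶜ (a + Pi.single j 1)) (hb : SquarefreeOn (evenIndices q) b)
    (hm : a + b = m) (hj : IsLeast (support m) j) :
    koszulHomotopy x B i
        (x j • contraction q i j (koszulTerm q (i + 1) b (orderedMonomial x a))) =
      koszulTerm q (i + 1) b (orderedMonomial x a) := by
  obtain ⟨c, rfl⟩ := exists_eq_add_single hbj
  have hlow (t : Fin n) (ht : t < j) : a t = 0 ∧ c t = 0 := by
    have := notMem_support.1 (mt (@hj.2 t) ht.not_ge)
    simpa [← hm, ht.ne] using this
  rw [hx.smul_contraction_koszulTerm hb, map_smul,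
    koszulHomotopy_koszulTerm_add_single hB haj (by rw [← hm]; abel) hj,
    swapCoeff_eq_one fun t ht => (hlow t ht).2, swapCoeff_eq_one fun t ht => (hlow t ht).1, one_mul,
    one_smul]

theorem contraction_homotopy_lead (ha : SquarefreeOn (evenIndices q)ᶜ a)
    (hb : SquarefreeOn (evenIndices q) b) (hm : a + b = m) (hj : IsLeast (support m) j) :
    x j • contraction q (i + 1) j
        (koszulHomotopy x B (i + 1) (koszulTerm q (i + 1) b (orderedMonomial x a))) +
      koszulHomotopy x B i
        (x j • contraction q i j (koszulTerm q (i + 1) b (orderedMonomial x a))) =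
      koszulTerm q (i + 1) b (orderedMonomial x a) := by
  have hjm : a j ≠ 0 ∨ b j ≠ 0 := by
    have : m j ≠ 0 := hj.1
    simp only [← hm, Pi.add_apply] at this
    omega
  by_cases hje : j ∈ evenIndices q
  · have haj : SquarefreeOn (evenIndices q)ᶜ (a + Pi.single j 1) :=
      squarefreeOn_add_single_iff.2 ⟨ha, fun h => absurd hje h⟩
    by_cases hbj : b j = 0
    · have hbj' := squarefreeOn_add_single_iff.2 ⟨hb, fun _ => hbj⟩
      rw [hx.smul_contraction_koszulHomotopy_lead hB (hjm.resolve_right (not_not.2 hbj)) ha hbj' hm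
        hj, contraction_koszulTerm_of_eq_zero _ hbj, smul_zero, map_zero, add_zero]
    · have hbj' : ¬SquarefreeOn (evenIndices q) (b + Pi.single j 1) := fun h =>
        hbj ((squarefreeOn_add_single_iff.1 h).2 hje)
      rw [hx.koszulHomotopy_smul_contraction_lead hB hbj haj hb hm hj,
        koszulHomotopy_koszulTerm hB ha (hm ▸ hj), koszulTerm_of_not_squarefreeOn hbj', ite_self,
        map_zero, smul_zero, zero_add]
  · have hbj : SquarefreeOn (evenIndices q) (b + Pi.single j 1) :=
      squarefreeOn_add_single_iff.2 ⟨hb, fun h => absurd h hje⟩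
    by_cases haj : a j = 0
    · have haj' := squarefreeOn_add_single_iff.2 ⟨ha, fun _ => haj⟩
      rw [hx.koszulHomotopy_smul_contraction_lead hB (hjm.resolve_left (not_not.2 haj)) haj' hb hm
        hj, hx.koszulHomotopy_koszulTerm_of_eq_zero hB haj hm hj, map_zero, smul_zero, zero_add]
    · have haj' : ¬SquarefreeOn (evenIndices q)ᶜ (a + Pi.single j 1) := fun h =>
        haj ((squarefreeOn_add_single_iff.1 h).2 hje)
      rw [hx.smul_contraction_koszulHomotopy_lead hB haj ha hbj hm hj, add_eq_left]
      by_cases hbj₀ : b j = 0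
      · rw [contraction_koszulTerm_of_eq_zero _ hbj₀, smul_zero, map_zero]
      · obtain ⟨c, rfl⟩ := exists_eq_add_single hbj₀
        rw [hx.smul_contraction_koszulTerm hb, hx.orderedMonomial_eq_zero haj', map_zero, smul_zero,
          map_zero]

theorem koszulD_homotopy (z : KoszulModule q R (i + 1)) :
    koszulD q x (i + 1) (koszulHomotopy x B (i + 1) z) + koszulHomotopy x B i (koszulD q x i z) =
      z := by
  suffices (koszulD q x (i + 1)).restrictScalars k ∘ₗ koszulHomotopy x B (i + 1) +
      koszulHomotopy x B i ∘ₗ (koszulD q x i).restrictScalars k = LinearMap.id from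
    LinearMap.congr_fun this z
  refine Finsupp.lhom_ext' fun b => B.ext fun a => ?_
  simp only [LinearMap.comp_apply, LinearMap.add_apply, Finsupp.lsingle_apply,
    LinearMap.restrictScalars_apply, LinearMap.id_apply, hB, ← koszulTerm_exponent]
  have hab : a.1 + b.exponent ≠ 0 := fun h => by
    have hsum := b.sum_eq
    simp [(add_eq_zero.1 h).2] at hsum
  obtain ⟨j, hj⟩ := exists_isLeast_support hab
  rw [koszulD_apply, koszulD_apply, map_sum, ← Finset.sum_add_distrib,
    Finset.sum_eq_single_of_mem j (Finset.mem_univ j) fun l _ hlj =>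
      hx.contraction_homotopy_of_ne hB hlj a.2 b.squarefreeOn rfl hj]
  exact hx.contraction_homotopy_lead hB a.2 b.squarefreeOn rfl hj

end SkewCommute

end Homotopy

/-! ### Koszulity of skew commutative algebras -/

theorem mem_pow_span_one (x : Fin n → R) (l : Fin n) :
    x l ∈ Submodule.span k (Set.range x) ^ 1 := by
  rw [pow_one]
  exact Submodule.subset_span (Set.mem_range_self l)

theorem augIdeal_pow_span (x : Fin n → R) :
    augIdeal (fun m => Submodule.span k (Set.range x) ^ m) =
      Submodule.span Rᵐᵒᵖ (Set.range x) := by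
  refine le_antisymm (Submodule.span_le.2 ?_) (Submodule.span_le.2 ?_)
  · rintro r ⟨m, hm, hr⟩
    obtain ⟨m, rfl⟩ := Nat.exists_eq_succ_of_ne_zero hm.ne'
    replace hr : r ∈ Submodule.span k (Set.range x) * Submodule.span k (Set.range x) ^ m :=
      pow_succ' (Submodule.span k (Set.range x)) m ▸ hr
    induction hr using Submodule.mul_induction_on' with
    | mem_mul_mem s hs t _ =>
      rw [← op_smul_eq_mul]
      exact Submodule.smul_mem _ _ (Submodule.span_le_restrictScalars k Rᵐᵒᵖ _ hs)
    | add s _ t _ hs ht => exact add_mem hs ht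
  · rintro _ ⟨l, rfl⟩
    exact mem_augIdeal_of_mem one_ne_zero (mem_pow_span_one x l)

/-- The augmentation of the Koszul complex onto the trivial right module. -/
noncomputable def koszulAug (q : Fin n → Fin n → k) (𝒜 : ℕ → Submodule k R) :
    KoszulModule q R 0 →ₗ[Rᵐᵒᵖ] R ⧸ augIdeal 𝒜 :=
  (augIdeal 𝒜).mkQ ∘ₗ
    (Finsupp.uniqueLinearEquiv Rᵐᵒᵖ R (default : KoszulGen.{u, v} q 0)).toLinearMap

theorem koszulAug_apply (𝒜 : ℕ → Submodule k R) (z : KoszulModule q R 0) :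
    koszulAug q 𝒜 z = Submodule.Quotient.mk (z default) :=
  rfl

theorem koszulD_zero_koszulTerm (x : Fin n → R) (l : Fin n) :
    koszulD q x 0 (koszulTerm q 1 (0 + Pi.single l 1) 1) = Finsupp.single default (x l) := by
  have hl : SquarefreeOn (evenIndices q) (0 + Pi.single l 1) :=
    squarefreeOn_add_single_iff.2 ⟨fun _ _ => Nat.zero_le _, fun _ => rfl⟩
  rw [koszulD_apply, Finset.sum_eq_single_of_mem l (Finset.mem_univ l) fun t _ ht => by
    rw [contraction_koszulTerm_of_eq_zero _ (by simp [ht]), smul_zero],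
    contraction_koszulTerm_add_single _ hl, swapCoeff_eq_one (a := 0) fun _ _ => rfl, one_smul,
    smul_koszulTerm, mul_one]
  exact koszulTerm_exponent (default : KoszulGen.{u, v} q 0) (x l)

theorem exact_koszulD_koszulAug (x : Fin n → R) :
    Function.Exact (koszulD q x 0)
      (koszulAug q fun m => Submodule.span k (Set.range x) ^ m) := by
  intro z
  rw [koszulAug_apply, Submodule.Quotient.mk_eq_zero, augIdeal_pow_span]
  constructor
  · intro hz
    have hle : Submodule.span Rᵐᵒᵖ (Set.range x) ≤
        (LinearMap.range (koszulD q x 0)).comap (Finsupp.lsingle default) := by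
      refine Submodule.span_le.2 ?_
      rintro _ ⟨l, rfl⟩
      exact ⟨_, koszulD_zero_koszulTerm x l⟩
    rw [Finsupp.unique_single z]
    exact hle hz
  · rintro ⟨w, rfl⟩
    rw [koszulD_apply, Finsupp.finsetSum_apply]
    refine sum_mem fun l _ => ?_
    rw [Finsupp.smul_apply, smul_eq_mul, ← op_smul_eq_mul]
    exact Submodule.smul_mem _ _ (Submodule.subset_span ⟨l, rfl⟩)

/-- The Koszul resolution over an algebra generated by skew commuting elements `x`, whose ordered
monomials form a basis `B`. -/
noncomputable def SkewCommute.koszulResolution {x : Fin n → R} (hx : SkewCommute q x)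
    {B : Module.Basis (PBWIndex q) k R} (hB : ∀ a, B a = orderedMonomial x a) :
    FreeResolution.{u, v, v} fun m => Submodule.span k (Set.range x) ^ m where
  gen := KoszulGen.{u, v} q
  deg i _ := i
  d := koszulD q x
  aug := koszulAug q _
  d_mem i :=
    have := Submodule.nat_power_gradedMonoid (Submodule.span k (Set.range x))
    preservesDegree_koszulD (mem_pow_span_one x)
  aug_mem j f hf := ⟨f default, by simpa using hf default, rfl⟩
  aug_surjective := (Submodule.mkQ_surjective _).comp (LinearEquiv.surjective _)
  exact_aug := exact_koszulD_koszulAug x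
  exact_d i z := by
    refine ⟨fun hz => ⟨koszulHomotopy x B (i + 1) z, ?_⟩, ?_⟩
    · simpa only [hz, map_zero, add_zero] using hx.koszulD_homotopy hB z
    · rintro ⟨w, rfl⟩
      exact hx.koszulD_koszulD w

theorem SkewCommute.isHomogeneousKoszul {x : Fin n → R} (hx : SkewCommute q x)
    (hstd : IsStandard fun m => Submodule.span k (Set.range x) ^ m)
    (hli : LinearIndependent k fun a : PBWIndex q => orderedMonomial x a) :
    IsHomogeneousKoszul fun m => Submodule.span k (Set.range x) ^ m := by
  have hgen : Algebra.adjoin k (Set.range x) = ⊤ := by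
    simpa only [pow_one, Algebra.adjoin_span] using hstd.adjoin_one
  exact hstd.isHomogeneousKoszul (hx.koszulResolution (hx.monomialBasis_apply hgen hli))
    fun i => ⟨inferInstanceAs (Finite (KoszulGen q i)), fun _ => rfl⟩

end GradedKoszul

/-! ### The enveloping algebra -/

theorem exists_homogeneous_basis {k Γ L : Type*} [Field k] [DecidableEq Γ] [AddCommGroup L]
    [Module k L] [FiniteDimensional k L] {A : Γ → Submodule k L} (hA : DirectSum.IsInternal A) :
    ∃ (n : ℕ) (b : Module.Basis (Fin n) k L) (deg : Fin n → Γ), (∀ i, b i ∈ A (deg i)) ∧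
      ∀ α, ∀ a ∈ A α, ∀ i, b.repr a i ≠ 0 → deg i = α := by
  let v (γ : Γ) := Module.Basis.ofVectorSpace k (A γ)
  let B := hA.collectedBasis v
  have := Module.Finite.finite_basis B
  obtain ⟨n, ⟨e⟩⟩ := Finite.exists_equiv_fin (Σ γ, Module.Basis.ofVectorSpaceIndex k (A γ))
  refine ⟨n, B.reindex e, fun i => (e.symm i).1, fun i => ?_, fun α a ha i hi => ?_⟩
  · rw [Module.Basis.reindex_apply]
    exact hA.collectedBasis_mem v _
  · contrapose! hi
    rw [Module.Basis.repr_reindex_apply]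
    exact hA.collectedBasis_repr_of_mem_ne v hi.symm ha

namespace ColorLieAlgebra

open GradedKoszul

open scoped DirectSum

variable {k Γ : Type*} [Field k] [AddCommGroup Γ] [DecidableEq Γ] {ε : CommutationFactor k Γ}
  {L : Type*} [AddCommGroup L] [Module k L]

section UniversalProperty

variable {g : ColorLieAlgebra ε L} {A : Type*} [Semiring A] [Algebra k A]

/-- The homomorphism from the enveloping algebra to an algebra `A` induced by a linear map to `A`
which turns the bracket into the color commutator. -/
noncomputable def envelopeLift (f : L →ₗ[k] A)
    (hf : ∀ α β, ∀ a ∈ g.component α, ∀ b ∈ g.component β,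
      f a * f b = (ε.toFun α β : k) • (f b * f a) + f (g.bracket a b)) : g.Envelope →ₐ[k] A :=
  RingQuot.liftAlgHom k ⟨TensorAlgebra.lift k f, by
    rintro _ _ ⟨α, β, a, b, ha, hb⟩
    rw [sub_eq_add_neg, ← neg_smul, map_add, map_smul, map_mul, map_mul]
    simp only [TensorAlgebra.lift_ι_apply]
    rw [hf α β a ha b hb, add_right_comm, ← add_smul, add_neg_cancel, zero_smul, zero_add]⟩

theorem envelopeLift_ι (f : L →ₗ[k] A)
    (hf : ∀ α β, ∀ a ∈ g.component α, ∀ b ∈ g.component β,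
      f a * f b = (ε.toFun α β : k) • (f b * f a) + f (g.bracket a b)) (a : L) :
    envelopeLift f hf (g.envelopeι a) = f a :=
  (RingQuot.liftAlgHom_mkAlgHom_apply ..).trans (TensorAlgebra.lift_ι_apply f a)

end UniversalProperty

variable (g : ColorLieAlgebra ε L)

theorem adjoin_range_envelopeι : Algebra.adjoin k (Set.range g.envelopeι) = ⊤ := by
  rw [envelopeι, LinearMap.coe_comp, Set.range_comp, AlgHom.coe_toLinearMap, ← AlgHom.map_adjoin,
    TensorAlgebra.adjoin_range_ι, Algebra.map_top]
  exact (AlgHom.range_eq_top _).2 (RingQuot.mkAlgHom_surjective k _)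

theorem envelope_algHom_ext {A : Type*} [Semiring A] [Algebra k A] {f₁ f₂ : g.Envelope →ₐ[k] A}
    (h : ∀ a, f₁ (g.envelopeι a) = f₂ (g.envelopeι a)) : f₁ = f₂ :=
  AlgHom.ext_of_adjoin_eq_top g.adjoin_range_envelopeι (Set.forall_mem_range.2 h)

theorem algebraMap_envelope_injective : Function.Injective (algebraMap k g.Envelope) :=
  Function.LeftInverse.injective
    (g := envelopeLift (g := g) (0 : L →ₗ[k] k) fun _ _ _ _ _ _ => by simp)
    fun c => AlgHom.commutes _ c

instance : SetLike.GradedMonoid g.envelopeDegree :=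
  Submodule.nat_power_gradedMonoid _

theorem envelopeι_mem_envelopeDegree (a : L) : g.envelopeι a ∈ g.envelopeDegree 1 := by
  rw [envelopeDegree, pow_one]
  exact LinearMap.mem_range_self _ a

/-- The canonical map `g → U(g)` with values in the direct sum of the components of `U(g)`. -/
noncomputable def gradedι : L →ₗ[k] ⨁ n, g.envelopeDegree n :=
  DirectSum.lof k ℕ (fun n => g.envelopeDegree n) 1 ∘ₗ
    g.envelopeι.codRestrict _ g.envelopeι_mem_envelopeDegree

theorem gradedι_apply (a : L) : g.gradedι a = DirectSum.of (fun n => g.envelopeDegree n) 1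
    ⟨g.envelopeι a, g.envelopeι_mem_envelopeDegree a⟩ :=
  rfl

namespace IsAbelian

variable {g} (hg : g.IsAbelian)
include hg

theorem envelopeι_mul_comm {α β : Γ} {a b : L} (ha : a ∈ g.component α) (hb : b ∈ g.component β) :
    g.envelopeι a * g.envelopeι b = (ε.toFun α β : k) • (g.envelopeι b * g.envelopeι a) := by
  have h := RingQuot.mkAlgHom_rel k (EnvelopeRel.comm (g := g) α β a b ha hb)
  rw [hg, map_zero, map_zero, map_sub, map_smul, map_mul, map_mul, sub_eq_zero] at h
  exact h

theorem gradedι_mul_comm {α β : Γ} {a b : L} (ha : a ∈ g.component α) (hb : b ∈ g.component β) :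
    g.gradedι a * g.gradedι b = (ε.toFun α β : k) • (g.gradedι b * g.gradedι a) := by
  rw [gradedι_apply, gradedι_apply, DirectSum.of_mul_of, DirectSum.of_mul_of,
    ← DirectSum.lof_eq_of k, ← DirectSum.lof_eq_of k, ← map_smul]
  exact congrArg _ (Subtype.ext (hg.envelopeι_mul_comm ha hb))

theorem isInternal_envelopeDegree : DirectSum.IsInternal g.envelopeDegree := by
  let f : g.Envelope →ₐ[k] ⨁ n, g.envelopeDegree n :=
    envelopeLift g.gradedι fun α β a ha b hb => by
      rw [hg, map_zero, add_zero, hg.gradedι_mul_comm ha hb]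
  have hf (a : L) : f (g.envelopeι a) = g.gradedι a := envelopeLift_ι _ _ a
  have hright : (DirectSum.coeAlgHom g.envelopeDegree).comp f = AlgHom.id k g.Envelope :=
    g.envelope_algHom_ext fun a => by
      rw [AlgHom.comp_apply, hf, gradedι_apply, DirectSum.coeAlgHom_of, AlgHom.id_apply]
  have hleft (i : ℕ) (y : g.envelopeDegree i) :
      f y = DirectSum.of (fun n => g.envelopeDegree n) i y := by
    obtain ⟨y, hy⟩ := y
    dsimp only
    induction hy using Submodule.pow_induction_on_left' with
    | algebraMap r => rw [AlgHom.commutes, DirectSum.algebraMap_apply]; rfl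
    | add y z i hy hz ihy ihz => rw [map_add, ihy, ihz, ← map_add]; rfl
    | mem_mul m hm i y hy ih =>
      obtain ⟨a, rfl⟩ := hm
      rw [map_mul, ih, hf, gradedι_apply, DirectSum.of_mul_of]
      exact DirectSum.of_eq_of_gradedMonoid_eq (Sigma.subtype_ext (add_comm _ _) rfl)
  let _ : GradedAlgebra g.envelopeDegree := GradedAlgebra.ofAlgHom _ f hright hleft
  exact DirectSum.Decomposition.isInternal _

theorem isStandard_envelopeDegree [FiniteDimensional k L] : IsStandard g.envelopeDegree where
  gradedMonoid := inferInstance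
  isInternal := hg.isInternal_envelopeDegree
  finite n := by
    rw [Module.Finite.iff_fg, envelopeDegree, LinearMap.range_eq_map]
    exact (Module.Finite.fg_top.map g.envelopeι).pow n
  algebraMap_injective := g.algebraMap_envelope_injective
  zero_eq := by rw [envelopeDegree, pow_zero, Submodule.one_eq_range]
  adjoin_one := by rw [envelopeDegree, pow_one, LinearMap.coe_range, adjoin_range_envelopeι]

variable {n : ℕ} {deg : Fin n → Γ}

theorem skewCommute_envelopeι {b : Fin n → L} (hb : ∀ i, b i ∈ g.component (deg i)) :
    SkewCommute (fun i j => (ε.toFun (deg i) (deg j) : k)) fun i => g.envelopeι (b i) :=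
  fun i j => hg.envelopeι_mul_comm (hb i) (hb j)

theorem exists_algHom_of_skewCommute {A : Type*} [Ring A] [Algebra k A]
    (b : Module.Basis (Fin n) k L)
    (hb : ∀ α, ∀ a ∈ g.component α, ∀ i, b.repr a i ≠ 0 → deg i = α) {y : Fin n → A}
    (hy : SkewCommute (fun i j => (ε.toFun (deg i) (deg j) : k)) y) :
    ∃ ρ : g.Envelope →ₐ[k] A, ∀ i, ρ (g.envelopeι (b i)) = y i := by
  refine ⟨envelopeLift (b.constr k y) fun α β c hc d hd => ?_, fun i => ?_⟩
  · rw [hg, map_zero, add_zero]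
    simp only [b.constr_apply_fintype k, Module.Basis.equivFun_apply, Finset.sum_mul_sum,
      Finset.smul_sum]
    rw [Finset.sum_comm]
    refine Finset.sum_congr rfl fun j _ => Finset.sum_congr rfl fun i _ => ?_
    by_cases hi : b.repr c i = 0
    · simp only [hi, zero_smul, zero_mul, mul_zero, smul_zero]
    by_cases hj : b.repr d j = 0
    · simp only [hj, zero_smul, zero_mul, mul_zero, smul_zero]
    have hij : y i * y j = (ε.toFun α β : k) • (y j * y i) := by
      rw [← hb α c hc i hi, ← hb β d hd j hj, hy]
    rw [smul_mul_smul_comm, smul_mul_smul_comm, hij, smul_comm, mul_comm (b.repr c i)]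
  · rw [envelopeLift_ι, b.constr_basis]

end IsAbelian

theorem envelopeDegree_eq_span_pow {ι : Type*} (b : Module.Basis ι k L) :
    g.envelopeDegree = fun m => Submodule.span k (Set.range fun i => g.envelopeι (b i)) ^ m := by
  funext m
  rw [envelopeDegree, LinearMap.range_eq_map, ← b.span_eq, Submodule.map_span, ← Set.range_comp]
  rfl

end ColorLieAlgebra

open GradedKoszul in
theorem mainTheorem5_general {k Γ L : Type*} [Field k] [AddCommGroup Γ] [DecidableEq Γ]
    (ε : CommutationFactor k Γ) [AddCommGroup L] [Module k L] [FiniteDimensional k L]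
    (g : ColorLieAlgebra ε L) (hg : g.IsAbelian) : IsHomogeneousKoszul g.envelopeDegree := by
  obtain ⟨n, b, deg, hdeg, hrepr⟩ := exists_homogeneous_basis g.isInternal
  let q (i j : Fin n) : k := ε.toFun (deg i) (deg j)
  have hq (i j : Fin n) : q i j * q j i = 1 := by
    rw [← Units.val_mul, ε.mul_swap, Units.val_one]
  have hx : SkewCommute q fun i => g.envelopeι (b i) := hg.skewCommute_envelopeι hdeg
  obtain ⟨ρ, hρ⟩ := hg.exists_algHom_of_skewCommute b hrepr (skewCommute_regularRep hq)
  have hstd := hg.isStandard_envelopeDegree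
  rw [g.envelopeDegree_eq_span_pow b] at hstd ⊢
  exact hx.isHomogeneousKoszul hstd
    (hx.linearIndependent_orderedMonomial (fun i j => Units.ne_zero _) hρ)

theorem mainTheorem5 {k Γ L : Type*} [Field k] (h2 : ringChar k ≠ 2) (h3 : ringChar k ≠ 3)
    [AddCommGroup Γ] [DecidableEq Γ] (ε : CommutationFactor k Γ)
    [AddCommGroup L] [Module k L] [FiniteDimensional k L]
    (g : ColorLieAlgebra ε L) (hg : g.IsAbelian) :
    GradedKoszul.IsHomogeneousKoszul g.envelopeDegree :=
  mainTheorem5_general ε g hg
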